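/- Let $\phi(t)=\tfrac23 t^{3/2}$ and $\mathbb{R}^{1+1}_+=\{(t,x)\in\mathbb{R}^2: t>0\}$. Let $5<p<9$ and $q=p+1$. Then there exist real numbers $\alpha,\beta$ (depending only on $q$) with $$\alpha+\frac16+\beta=\frac{5}{3q},\qquad \beta<\frac1q,$$ and a constant $C>0$, depending only on $q,\alpha,\beta$, such that the following holds. Let $w$ and $F$ be real functions that are integrable on compact subsets of $\{t\ge 0\}$, and let $w$ be a weak solution of $$\partial_t^2 w-t\,\partial_x^2 w=F \ \text{ in } \mathbb{R}^{1+1}_+,\qquad w(0,x)=0,\quad \partial_t w(0,x)=0,$$ that is, $\iint_{t>0} w\,(\partial_t^2\psi-t\,\partial_x^2\psi)\,dx\,dt=\iint_{t>0}F\,\psi\,dx\,dt$ for every $\psi\in C_c^\infty(\mathbb{R}^2)$. If $F(t,x)=0$ for almost every $(t,x)\in\mathbb{R}^{1+1}_+$ with $|x|>\phi(t)-1$, then also $w(t,x)=0$ for almost every $(t,x)\in\mathbb{R}^{1+1}_+$ with $|x|>\phi(t)-1$, and $$\big\|(\phi(t)^2-|x|^2)^{-\alpha}w\big\|_{L^q(\mathbb{R}^{1+1}_+)}\le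 C\,\big\|(\phi(t)^2-|x|^2)^{\beta}F\big\|_{L^{q/(q-1)}(\mathbb{R}^{1+1}_+)}$$ (with the convention that the inequality holds trivially if the right-hand side is infinite). -/

import Mathlib

open MeasureTheory Set
open scoped ContDiff ENNReal

noncomputable section

/-- The function `φ(t) = (2/3) t^{3/2}`, for `t ≥ 0`. -/
def tricomiPhi (t : ℝ) : ℝ := 2 / 3 * t ^ (3 / 2 : ℝ)

/-- Lebesgue measure on the half plane `ℝ^{1+1}_+ = {(t, x) : t > 0}`; points are pairs `(t, x)`. -/
def halfPlaneMeasure : Measure (ℝ × ℝ) :=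
  volume.restrict {z : ℝ × ℝ | 0 < z.1}

/-- The Tricomi operator `∂_t² ψ - t ∂_x² ψ`. It is formally self-adjoint, since the
coefficient `t` does not depend on `x`. -/
def tricomiOp (ψ : ℝ × ℝ → ℝ) (z : ℝ × ℝ) : ℝ :=
  iteratedDeriv 2 (fun t => ψ (t, z.2)) z.1 - z.1 * iteratedDeriv 2 (fun x => ψ (z.1, x)) z.2

/-- `w` is a weak (distributional) solution on `t > 0` of `∂_t² w - t ∂_x² w = F` with the initial
data `w(0, x) = 0`, `∂_t w(0, x) = 0`. Both functions are integrable on compact subsets of the closed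
half plane `t ≥ 0`. The test functions need not vanish at `t = 0`, and no boundary
term appears in the identity: this is what encodes the two zero initial conditions. -/
structure IsWeakTricomiSolution (w F : ℝ × ℝ → ℝ) : Prop where
  locallyIntegrable_sol : LocallyIntegrableOn w {z : ℝ × ℝ | 0 ≤ z.1} volume
  locallyIntegrable_rhs : LocallyIntegrableOn F {z : ℝ × ℝ | 0 ≤ z.1} volume
  weak_eq : ∀ ψ : ℝ × ℝ → ℝ, ContDiff ℝ ∞ ψ → HasCompactSupport ψ →
    ∫ z, w z * tricomiOp ψ z ∂halfPlaneMeasure = ∫ z, F z * ψ z ∂halfPlaneMeasure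

end

/-!
The estimate rests on a pointwise bound with a positive kernel, so that no oscillation has to be
exploited: for almost every `(t, x)` and every `c > φ(t)`,
`|w(t, x)| ≤ ½ ∫∫ s^{-1/2} |F(s, y)| dy ds` over the backward characteristic cone
`|y - x| + φ(s) ≤ c`. The explicit Riemann function (a hypergeometric function) is not needed for it.

For smooth `w` vanishing near `t ≤ 0`, pass to the characteristic coordinates `u = φ(t) + x`,
`v = φ(t) - x`. The derivatives `A = w_u`, `B = w_v` satisfy the system
`A_v = B_u = F / (4t) - m (A + B)` with `m ≥ 0`, whose zeroth order term is dissipative in `L¹`: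
`∂_v |A| + ∂_u |B| ≤ |F| / (2t)`. Integrated over the cone with apex `(u₀, v₀)`, this bounds
`∫ |A(u, v₀)| du + ∫ |B(u₀, v)| dv`, and each of the two terms dominates `|w|` at the apex
(`integral_abs_add_integral_abs_le`, `enorm_le_lintegral_tricomiCone`).

A weak solution extended by zero to `t ≤ 0` solves the equation on the whole plane, because the test
functions need not vanish at `t = 0`. It is mollified with kernels supported in `t > 0`. The
coefficient `t` produces a commutator, which tends to zero if the time scale of the kernel is much
smaller than its space scale (`tricomiOp_mollify`, `exists_isForwardMollifier`). The limit gives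
`ae_enorm_le_setLIntegral_tricomiCone`.

The vanishing of `w` for `|x| > φ(t) - 1` is then immediate. For the weighted estimate take
`α = 11 / (12 q)` and `β = 3 / (4 q) - 1 / 6`. As `α q < 1`, the weight `(φ² - x²)^{-α q}` is
integrable over the slices `|x| < φ(t)`; as `q > 6`, the power `(φ² - x²)^{-β q}` that Hölder's
inequality produces is bounded there. What remains is a Hardy inequality in the single variable `t`,
where the gain from `L^{q'}` to `L^q` comes from bounding all but one power of the truncated norm of
`F` by the full one (`lintegral_weighted_le`).
-/

/-! ### The `L¹` estimate for the characteristic system -/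

/-- A smooth even convex approximation of `|x|`, vanishing at `0`. -/
noncomputable def smoothAbs (δ x : ℝ) : ℝ := √(x ^ 2 + δ ^ 2) - δ

lemma smoothAbs_zero {δ : ℝ} (hδ : 0 < δ) : smoothAbs δ 0 = 0 := by
  simp [smoothAbs, Real.sqrt_sq hδ.le]

lemma abs_sub_le_smoothAbs (δ x : ℝ) : |x| - δ ≤ smoothAbs δ x := by
  have : |x| ≤ √(x ^ 2 + δ ^ 2) := Real.abs_le_sqrt (by nlinarith [sq_nonneg δ])
  unfold smoothAbs; linarith

lemma hasDerivAt_smoothAbs {δ : ℝ} (hδ : 0 < δ) (x : ℝ) :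
    HasDerivAt (smoothAbs δ) (x / √(x ^ 2 + δ ^ 2)) x := by
  have h : HasDerivAt (fun x : ℝ => x ^ 2 + δ ^ 2) (2 * x) x := by
    simpa using (hasDerivAt_pow 2 x).add_const (δ ^ 2)
  have := (h.sqrt (by positivity)).sub_const δ
  convert! this using 1
  field_simp

lemma continuous_smoothAbs_slope {δ : ℝ} (hδ : 0 < δ) :
    Continuous fun x : ℝ => x / √(x ^ 2 + δ ^ 2) :=
  continuous_id.div (by fun_prop) fun x => by positivity

lemma abs_smoothAbs_slope_le (δ x : ℝ) : |x / √(x ^ 2 + δ ^ 2)| ≤ 1 := by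
  rw [abs_div, abs_of_nonneg (Real.sqrt_nonneg _)]
  exact div_le_one_of_le₀ (Real.abs_le_sqrt (by nlinarith [sq_nonneg δ])) (Real.sqrt_nonneg _)

/-- The slope of `smoothAbs` is odd and increasing, so the sum of two slopes has the sign of the
sum of the arguments. -/
lemma smoothAbs_slope_add_mul_nonneg {δ : ℝ} (hδ : 0 < δ) (x y : ℝ) :
    0 ≤ (x / √(x ^ 2 + δ ^ 2) + y / √(y ^ 2 + δ ^ 2)) * (x + y) := by
  set a := √(x ^ 2 + δ ^ 2)
  set b := √(y ^ 2 + δ ^ 2)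
  have ha : 0 < a := by positivity
  have hb : 0 < b := by positivity
  have ha2 : a ^ 2 = x ^ 2 + δ ^ 2 := Real.sq_sqrt (by positivity)
  have hb2 : b ^ 2 = y ^ 2 + δ ^ 2 := Real.sq_sqrt (by positivity)
  have hxy : -(a * b) ≤ x * y := by
    have : |x * y| ≤ a * b := by
      rw [abs_mul]
      exact mul_le_mul (Real.abs_le_sqrt (by nlinarith [sq_nonneg δ]))
        (Real.abs_le_sqrt (by nlinarith [sq_nonneg δ])) (abs_nonneg _) ha.le
    linarith [neg_abs_le (x * y)]
  have key : (x / a + y / b) * (x + y) =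
      ((a * b + x * y) * (a + b) - δ ^ 2 * (a + b)) / (a * b) := by
    field_simp
    linear_combination (-b) * ha2 - a * hb2
  have h2 : δ ^ 2 ≤ a * b + x * y := by
    -- Cauchy-Schwarz for the vectors `(x, δ)` and `(-y, δ)`
    have h3 : (δ ^ 2 - x * y) ^ 2 ≤ (a * b) ^ 2 := by
      rw [mul_pow, ha2, hb2]; nlinarith [sq_nonneg (δ * (x + y))]
    have := abs_le_of_sq_le_sq h3 (by positivity)
    linarith [(abs_le.1 this).1, (abs_le.1 this).2]
  rw [key]
  apply div_nonneg _ (by positivity)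
  nlinarith [mul_le_mul_of_nonneg_right h2 (by positivity : 0 ≤ a + b)]

/-- The `L¹` estimate for the characteristic system `∂_v A = ∂_u B = g - m (A + B)`, `m ≥ 0`, on a
rectangle with zero data on the two lower sides: the zeroth order term is dissipative in `L¹`, so it
does not enter the bound. -/
lemma integral_abs_add_integral_abs_le {A B g m : ℝ × ℝ → ℝ} (hA : ContDiff ℝ 1 A)
    (hB : ContDiff ℝ 1 B) (hm : ∀ z, 0 ≤ m z)
    (hAv : ∀ z, fderiv ℝ A z (0, 1) = g z - m z * (A z + B z))
    (hBu : ∀ z, fderiv ℝ B z (1, 0) = g z - m z * (A z + B z))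
    {a₁ a₂ b₁ b₂ : ℝ} (h₁ : a₁ ≤ b₁) (h₂ : a₂ ≤ b₂)
    (hA0 : ∀ u ≤ b₁, A (u, a₂) = 0) (hB0 : ∀ v ≤ b₂, B (a₁, v) = 0) :
    ENNReal.ofReal ((∫ u in a₁..b₁, |A (u, b₂)|) + ∫ v in a₂..b₂, |B (b₁, v)|) ≤
      2 * ∫⁻ z in Icc a₁ b₁ ×ˢ Icc a₂ b₂, ‖g z‖ₑ := by
  set s : ℝ → ℝ → ℝ := fun δ x => x / √(x ^ 2 + δ ^ 2)
  have hAc := hA.continuous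
  have hBc := hB.continuous
  have hlim : ∀ δ > 0, ENNReal.ofReal ((∫ u in a₁..b₁, |A (u, b₂)|) + (∫ v in a₂..b₂, |B (b₁, v)|)
      - δ * ((b₁ - a₁) + (b₂ - a₂))) ≤ 2 * ∫⁻ z in Icc a₁ b₁ ×ˢ Icc a₂ b₂, ‖g z‖ₑ := by
    intro δ hδ
    set D : ℝ × ℝ → ℝ := fun z =>
      s δ (B z) * fderiv ℝ B z (1, 0) + s δ (A z) * fderiv ℝ A z (0, 1)
    have hsc : Continuous (s δ) := continuous_smoothAbs_slope hδ
    have hDc : Continuous D := by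
      have h1 := hA.continuous_fderiv one_ne_zero
      have h2 := hB.continuous_fderiv one_ne_zero
      exact ((hsc.comp hBc).mul (h2.clm_apply continuous_const)).add
        ((hsc.comp hAc).mul (h1.clm_apply continuous_const))
    have hjc : Continuous (smoothAbs δ) := by unfold smoothAbs; fun_prop
    have hdiv := integral2_divergence_prod_of_hasFDerivAt_off_countable
      (fun z => smoothAbs δ (B z)) (fun z => smoothAbs δ (A z))
      (fun z => s δ (B z) • fderiv ℝ B z) (fun z => s δ (A z) • fderiv ℝ A z)
      a₁ a₂ b₁ b₂ ∅ countable_empty (hjc.comp hBc).continuousOn (hjc.comp hAc).continuousOn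
      (fun z _ => (hasDerivAt_smoothAbs hδ (B z)).comp_hasFDerivAt z
        (hB.differentiable one_ne_zero z).hasFDerivAt)
      (fun z _ => (hasDerivAt_smoothAbs hδ (A z)).comp_hasFDerivAt z
        (hA.differentiable one_ne_zero z).hasFDerivAt)
      (by
        have : IntegrableOn D (uIcc a₁ b₁ ×ˢ uIcc a₂ b₂) :=
          hDc.continuousOn.integrableOn_compact (isCompact_uIcc.prod isCompact_uIcc)
        simpa [D, smul_eq_mul] using this)
    have hz1 : ∫ u in a₁..b₁, smoothAbs δ (A (u, a₂)) = 0 := by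
      rw [intervalIntegral.integral_of_le h₁]
      refine setIntegral_eq_zero_of_forall_eq_zero fun u hu => ?_
      rw [hA0 u hu.2, smoothAbs_zero hδ]
    have hz2 : ∫ v in a₂..b₂, smoothAbs δ (B (a₁, v)) = 0 := by
      rw [intervalIntegral.integral_of_le h₂]
      refine setIntegral_eq_zero_of_forall_eq_zero fun v hv => ?_
      rw [hB0 v hv.2, smoothAbs_zero hδ]
    rw [hz1, hz2, sub_zero, sub_zero] at hdiv
    have hlow1 : (∫ u in a₁..b₁, |A (u, b₂)|) - δ * (b₁ - a₁) ≤
        ∫ u in a₁..b₁, smoothAbs δ (A (u, b₂)) := by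
      have : (∫ u in a₁..b₁, |A (u, b₂)|) - δ * (b₁ - a₁) =
          ∫ u in a₁..b₁, (|A (u, b₂)| - δ) := by
        rw [intervalIntegral.integral_sub (Continuous.intervalIntegrable (by fun_prop) _ _)
          (by simp)]
        simp [mul_comm]
      rw [this]
      exact intervalIntegral.integral_mono_on h₁ (Continuous.intervalIntegrable (by fun_prop) _ _)
        (Continuous.intervalIntegrable (by fun_prop) _ _)
        fun u _ => abs_sub_le_smoothAbs _ _
    have hlow2 : (∫ v in a₂..b₂, |B (b₁, v)|) - δ * (b₂ - a₂) ≤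
        ∫ v in a₂..b₂, smoothAbs δ (B (b₁, v)) := by
      have : (∫ v in a₂..b₂, |B (b₁, v)|) - δ * (b₂ - a₂) =
          ∫ v in a₂..b₂, (|B (b₁, v)| - δ) := by
        rw [intervalIntegral.integral_sub (Continuous.intervalIntegrable (by fun_prop) _ _)
          (by simp)]
        simp [mul_comm]
      rw [this]
      exact intervalIntegral.integral_mono_on h₂ (Continuous.intervalIntegrable (by fun_prop) _ _)
        (Continuous.intervalIntegrable (by fun_prop) _ _)
        fun u _ => abs_sub_le_smoothAbs _ _
    have hDint : IntegrableOn D (Icc a₁ b₁ ×ˢ Icc a₂ b₂) :=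
      hDc.continuousOn.integrableOn_compact (isCompact_Icc.prod isCompact_Icc)
    have hprod : (∫ u in a₁..b₁, ∫ v in a₂..b₂, D (u, v)) =
        ∫ z in Icc a₁ b₁ ×ˢ Icc a₂ b₂, D z := by
      rw [Measure.volume_eq_prod, setIntegral_prod _ (by simpa [Measure.volume_eq_prod] using hDint)]
      simp only [intervalIntegral.integral_of_le h₁, intervalIntegral.integral_of_le h₂,
        integral_Icc_eq_integral_Ioc]
    have hDle : ∀ z, D z ≤ 2 * |g z| := by
      intro z
      have e : D z = (s δ (A z) + s δ (B z)) * g z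
          - m z * ((s δ (A z) + s δ (B z)) * (A z + B z)) := by
        simp only [D, hAv, hBu]; ring
      have h1 := mul_nonneg (hm z) (smoothAbs_slope_add_mul_nonneg hδ (A z) (B z))
      have h2 : |s δ (A z) + s δ (B z)| ≤ 2 := by
        have := abs_add_le (s δ (A z)) (s δ (B z))
        have := abs_smoothAbs_slope_le δ (A z)
        have := abs_smoothAbs_slope_le δ (B z)
        simp only [s] at *
        linarith
      have h3 : (s δ (A z) + s δ (B z)) * g z ≤ 2 * |g z| :=
        (le_abs_self _).trans (by rw [abs_mul]; gcongr)
      rw [e]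
      simp only [s] at *
      linarith
    calc ENNReal.ofReal _ ≤ ENNReal.ofReal (∫ z in Icc a₁ b₁ ×ˢ Icc a₂ b₂, D z) := by
          apply ENNReal.ofReal_le_ofReal
          rw [← hprod]
          have : (∫ u in a₁..b₁, ∫ v in a₂..b₂, D (u, v)) =
            (∫ u in a₁..b₁, smoothAbs δ (A (u, b₂))) +
              ∫ v in a₂..b₂, smoothAbs δ (B (b₁, v)) := by
            rw [← hdiv]; rfl
          rw [this]
          linarith
      _ ≤ ENNReal.ofReal (∫ z in Icc a₁ b₁ ×ˢ Icc a₂ b₂, max (D z) 0) :=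
          ENNReal.ofReal_le_ofReal
            (integral_mono hDint hDint.pos_part fun z => le_max_left _ _)
      _ = ∫⁻ z in Icc a₁ b₁ ×ˢ Icc a₂ b₂, ENNReal.ofReal (max (D z) 0) :=
          ofReal_integral_eq_lintegral_ofReal hDint.pos_part
            (Filter.Eventually.of_forall fun z => le_max_right _ _)
      _ ≤ ∫⁻ z in Icc a₁ b₁ ×ˢ Icc a₂ b₂, 2 * ‖g z‖ₑ := by
          refine lintegral_mono fun z => ?_
          have : max (D z) 0 ≤ 2 * |g z| := max_le (hDle z) (by positivity)
          refine (ENNReal.ofReal_le_ofReal this).trans ?_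
          rw [ENNReal.ofReal_mul (by norm_num), ← Real.norm_eq_abs, ofReal_norm]
          simp
      _ = _ := lintegral_const_mul' _ _ (by simp)
  refine le_of_tendsto (f := fun δ => ENNReal.ofReal ((∫ u in a₁..b₁, |A (u, b₂)|) +
    (∫ v in a₂..b₂, |B (b₁, v)|) - δ * ((b₁ - a₁) + (b₂ - a₂)))) (x := nhdsWithin 0 (Ioi 0)) ?_
    (Filter.eventually_of_mem self_mem_nhdsWithin fun δ hδ => hlim δ hδ)
  have : Continuous fun δ : ℝ => ENNReal.ofReal ((∫ u in a₁..b₁, |A (u, b₂)|) +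
    (∫ v in a₂..b₂, |B (b₁, v)|) - δ * ((b₁ - a₁) + (b₂ - a₂))) :=
    ENNReal.continuous_ofReal.comp (by fun_prop)
  have h := this.tendsto 0
  simp only [zero_mul, sub_zero] at h
  exact h.mono_left nhdsWithin_le_nhds

/-! ### Characteristic coordinates -/

lemma continuous_tricomiPhi : Continuous tricomiPhi := by
  unfold tricomiPhi
  exact continuous_const.mul (Real.continuous_rpow_const (by norm_num))

lemma tricomiPhi_pos {t : ℝ} (ht : 0 < t) : 0 < tricomiPhi t := by
  unfold tricomiPhi; positivity

lemma strictMonoOn_tricomiPhi : StrictMonoOn tricomiPhi (Ici 0) := fun s hs t _ hst => by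
  unfold tricomiPhi
  have := Real.rpow_lt_rpow hs hst (show (0 : ℝ) < 3 / 2 by norm_num)
  linarith

lemma hasDerivAt_tricomiPhi (t : ℝ) : HasDerivAt tricomiPhi (√t) t := by
  have h := (Real.hasDerivAt_rpow_const (x := t) (p := 3 / 2) (Or.inr (by norm_num))).const_mul
    (2 / 3 : ℝ)
  convert! h using 1
  rw [Real.sqrt_eq_rpow]
  norm_num
  ring

/-- The inverse `T ↦ (3T/2)^{2/3}` of `tricomiPhi`, extended by `0` to `T ≤ 0`. -/
noncomputable def tricomiTime (T : ℝ) : ℝ := (max (3 / 2 * T) 0) ^ (2 / 3 : ℝ)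

lemma continuous_tricomiTime : Continuous tricomiTime := by
  unfold tricomiTime
  exact (Real.continuous_rpow_const (by norm_num)).comp (by fun_prop)

lemma tricomiTime_of_nonpos {T : ℝ} (hT : T ≤ 0) : tricomiTime T = 0 := by
  unfold tricomiTime
  rw [max_eq_right (by linarith), Real.zero_rpow (by norm_num)]

lemma tricomiTime_pos {T : ℝ} (hT : 0 < T) : 0 < tricomiTime T := by
  unfold tricomiTime
  exact Real.rpow_pos_of_pos (lt_max_of_lt_left (by linarith)) _

lemma tricomiPhi_tricomiTime {T : ℝ} (hT : 0 ≤ T) : tricomiPhi (tricomiTime T) = T := by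
  unfold tricomiTime tricomiPhi
  rw [max_eq_left (by linarith), ← Real.rpow_mul (by linarith)]
  norm_num
  ring

lemma tricomiTime_tricomiPhi {t : ℝ} (ht : 0 ≤ t) : tricomiTime (tricomiPhi t) = t := by
  have h0 : 0 ≤ t ^ (3 / 2 : ℝ) := by positivity
  unfold tricomiTime tricomiPhi
  rw [max_eq_left (by positivity), show 3 / 2 * (2 / 3 * t ^ (3 / 2 : ℝ)) = t ^ (3 / 2 : ℝ) by ring,
    ← Real.rpow_mul ht]
  norm_num

lemma hasDerivAt_tricomiTime {T : ℝ} (hT : 0 < T) :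
    HasDerivAt tricomiTime (√(tricomiTime T))⁻¹ T := by
  refine HasDerivAt.of_local_left_inverse (f := tricomiPhi) continuous_tricomiTime.continuousAt
    (hasDerivAt_tricomiPhi _) (by have := tricomiTime_pos hT; positivity) ?_
  filter_upwards [Ioi_mem_nhds hT] with S hS using tricomiPhi_tricomiTime (le_of_lt hS)

lemma contDiffAt_tricomiTime {T : ℝ} (hT : 0 < T) {n : WithTop ℕ∞} :
    ContDiffAt ℝ n tricomiTime T := by
  have h : ContDiffAt ℝ n (fun T : ℝ => (3 / 2 * T) ^ (2 / 3 : ℝ)) T :=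
    ContDiffAt.rpow_const_of_ne (by fun_prop) (by positivity)
  refine h.congr_of_eventuallyEq ?_
  filter_upwards [Ioi_mem_nhds hT] with S hS
  unfold tricomiTime
  rw [max_eq_left (by linarith [show (0 : ℝ) < S from hS])]

/-- The `t`-derivative of a function on the plane. -/
noncomputable def partialT (f : ℝ × ℝ → ℝ) (z : ℝ × ℝ) : ℝ := fderiv ℝ f z (1, 0)

/-- The `x`-derivative of a function on the plane. -/
noncomputable def partialX (f : ℝ × ℝ → ℝ) (z : ℝ × ℝ) : ℝ := fderiv ℝ f z (0, 1)

lemma fderiv_apply_eq_partial (f : ℝ × ℝ → ℝ) (z : ℝ × ℝ) (a b : ℝ) :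
    fderiv ℝ f z (a, b) = a * partialT f z + b * partialX f z := by
  have : ((a, b) : ℝ × ℝ) = a • (1, 0) + b • (0, 1) := by simp
  rw [this, map_add, map_smul, map_smul]; rfl

lemma contDiff_fderiv_apply_const {f : ℝ × ℝ → ℝ} (hf : ContDiff ℝ ∞ f) (e : ℝ × ℝ) :
    ContDiff ℝ ∞ fun z => fderiv ℝ f z e :=
  (hf.fderiv_right (m := ∞) (by simp)).clm_apply contDiff_const

lemma contDiff_partialT {f : ℝ × ℝ → ℝ} (hf : ContDiff ℝ ∞ f) : ContDiff ℝ ∞ (partialT f) :=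
  contDiff_fderiv_apply_const hf _

lemma contDiff_partialX {f : ℝ × ℝ → ℝ} (hf : ContDiff ℝ ∞ f) : ContDiff ℝ ∞ (partialX f) :=
  contDiff_fderiv_apply_const hf _

lemma fderiv_fderiv_apply_comm {f : ℝ × ℝ → ℝ} (hf : ContDiff ℝ ∞ f) (z d e : ℝ × ℝ) :
    fderiv ℝ (fun z => fderiv ℝ f z d) z e = fderiv ℝ (fun z => fderiv ℝ f z e) z d := by
  have h1 : DifferentiableAt ℝ (fderiv ℝ f) z :=
    (hf.fderiv_right (m := ∞) (by simp)).differentiable (by simp) z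
  rw [fderiv_clm_apply h1 (differentiableAt_const _), fderiv_clm_apply h1 (differentiableAt_const _)]
  simpa using hf.contDiffAt.isSymmSndFDerivAt (x := z)
    (by simp only [minSmoothness_of_isRCLikeNormedField]; exact WithTop.coe_le_coe.2 (le_top : (2 : ℕ∞) ≤ ⊤)) e d

lemma partialT_partialX {f : ℝ × ℝ → ℝ} (hf : ContDiff ℝ ∞ f) (z : ℝ × ℝ) :
    partialT (partialX f) z = partialX (partialT f) z :=
  fderiv_fderiv_apply_comm hf z _ _

lemma hasDerivAt_fst_slice {f : ℝ × ℝ → ℝ} (hf : Differentiable ℝ f) (z : ℝ × ℝ) :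
    HasDerivAt (fun t => f (t, z.2)) (partialT f z) z.1 :=
  (hf z).hasFDerivAt.comp_hasDerivAt z.1 ((hasDerivAt_id z.1).prodMk (hasDerivAt_const z.1 z.2))

lemma hasDerivAt_snd_slice {f : ℝ × ℝ → ℝ} (hf : Differentiable ℝ f) (z : ℝ × ℝ) :
    HasDerivAt (fun x => f (z.1, x)) (partialX f z) z.2 :=
  (hf z).hasFDerivAt.comp_hasDerivAt z.2 ((hasDerivAt_const z.2 z.1).prodMk (hasDerivAt_id z.2))

lemma tricomiOp_eq_partial {f : ℝ × ℝ → ℝ} (hf : ContDiff ℝ ∞ f) (z : ℝ × ℝ) :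
    tricomiOp f z = partialT (partialT f) z - z.1 * partialX (partialX f) z := by
  have h1 : deriv (fun t => f (t, z.2)) = fun t => partialT f (t, z.2) :=
    funext fun t => (hasDerivAt_fst_slice (hf.differentiable (by simp)) (t, z.2)).deriv
  have h2 : deriv (fun x => f (z.1, x)) = fun x => partialX f (z.1, x) :=
    funext fun x => (hasDerivAt_snd_slice (hf.differentiable (by simp)) (z.1, x)).deriv
  unfold tricomiOp
  rw [iteratedDeriv_succ, iteratedDeriv_one, iteratedDeriv_succ, iteratedDeriv_one, h1, h2,
    (hasDerivAt_fst_slice ((contDiff_partialT hf).differentiable (by simp)) z).deriv,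
    (hasDerivAt_snd_slice ((contDiff_partialX hf).differentiable (by simp)) z).deriv]

/-- The inverse of the characteristic coordinates `(t, x) ↦ (φ(t) + x, φ(t) - x)`. -/
noncomputable def ofCharCoord (z : ℝ × ℝ) : ℝ × ℝ :=
  (tricomiTime ((z.1 + z.2) / 2), (z.1 - z.2) / 2)

lemma continuous_ofCharCoord : Continuous ofCharCoord := by
  unfold ofCharCoord
  exact (continuous_tricomiTime.comp (by fun_prop)).prodMk (by fun_prop)

lemma contDiffAt_ofCharCoord {z : ℝ × ℝ} (hz : 0 < z.1 + z.2) : ContDiffAt ℝ ∞ ofCharCoord z := by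
  unfold ofCharCoord
  refine ContDiffAt.prodMk ?_ (by fun_prop)
  have hT : 0 < (z.1 + z.2) / 2 := by linarith
  exact ContDiffAt.comp (g := tricomiTime) (f := fun z : ℝ × ℝ => (z.1 + z.2) / 2) z
    (contDiffAt_tricomiTime hT) (by fun_prop)

lemma contDiff_comp_ofCharCoord {W : ℝ × ℝ → ℝ} (hW : ContDiff ℝ ∞ W) {ε : ℝ} (hε : 0 < ε)
    (h0 : ∀ z : ℝ × ℝ, z.1 ≤ ε → W z = 0) : ContDiff ℝ ∞ (W ∘ ofCharCoord) := by
  refine contDiff_iff_contDiffAt.2 fun z => ?_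
  rcases lt_or_ge 0 (z.1 + z.2) with hz | hz
  · exact hW.contDiffAt.comp z (contDiffAt_ofCharCoord hz)
  · have h1 : (ofCharCoord z).1 < ε := by
      rw [ofCharCoord, tricomiTime_of_nonpos (by linarith)]; exact hε
    have h2 : ∀ᶠ y in nhds z, (ofCharCoord y).1 < ε :=
      (continuous_fst.comp continuous_ofCharCoord).continuousAt.eventually_lt
        continuousAt_const h1
    refine contDiffAt_const (c := (0 : ℝ)) |>.congr_of_eventuallyEq ?_
    filter_upwards [h2] with y hy using h0 _ hy.le

lemma fderiv_comp_ofCharCoord {W : ℝ × ℝ → ℝ} (hW : Differentiable ℝ W) {z : ℝ × ℝ}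
    (hz : 0 < z.1 + z.2) (a b : ℝ) :
    fderiv ℝ (W ∘ ofCharCoord) z (a, b) =
      (√(ofCharCoord z).1)⁻¹ * ((a + b) / 2) * partialT W (ofCharCoord z) +
        (a - b) / 2 * partialX W (ofCharCoord z) := by
  have hl1 : HasFDerivAt (fun z : ℝ × ℝ => (z.1 + z.2) / 2)
      ((1 / 2 : ℝ) • (ContinuousLinearMap.fst ℝ ℝ ℝ + ContinuousLinearMap.snd ℝ ℝ ℝ)) z := by
    have := (hasFDerivAt_fst (𝕜 := ℝ) (p := z)).add (hasFDerivAt_snd (𝕜 := ℝ) (p := z))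
    have := this.const_mul (1 / 2 : ℝ)
    exact this.congr_of_eventuallyEq (Filter.Eventually.of_forall fun y => by simp; ring)
  have hl2 : HasFDerivAt (fun z : ℝ × ℝ => (z.1 - z.2) / 2)
      ((1 / 2 : ℝ) • (ContinuousLinearMap.fst ℝ ℝ ℝ - ContinuousLinearMap.snd ℝ ℝ ℝ)) z := by
    have := (hasFDerivAt_fst (𝕜 := ℝ) (p := z)).sub (hasFDerivAt_snd (𝕜 := ℝ) (p := z))
    have := this.const_mul (1 / 2 : ℝ)
    exact this.congr_of_eventuallyEq (Filter.Eventually.of_forall fun y => by simp; ring)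
  have hT : 0 < (z.1 + z.2) / 2 := by linarith
  have hΨ := ((hasDerivAt_tricomiTime hT).comp_hasFDerivAt z hl1).prodMk hl2
  change HasFDerivAt ofCharCoord _ z at hΨ
  rw [((hW (ofCharCoord z)).hasFDerivAt.comp z hΨ).fderiv]
  rw [ContinuousLinearMap.comp_apply, ContinuousLinearMap.prod_apply, fderiv_apply_eq_partial]
  simp [ofCharCoord]
  ring

/-- The backward characteristic cone `|x - x₀| ≤ c - φ(t)`, `t > 0`. For `c = φ(t₀)` its apex is
`(t₀, x₀)`. -/
def tricomiCone (c x₀ : ℝ) : Set (ℝ × ℝ) := {z | 0 < z.1 ∧ |z.2 - x₀| + tricomiPhi z.1 ≤ c}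

lemma measurableSet_tricomiCone (c x₀ : ℝ) : MeasurableSet (tricomiCone c x₀) := by
  have h := continuous_tricomiPhi
  have h1 : Continuous fun z : ℝ × ℝ => |z.2 - x₀| + tricomiPhi z.1 := by fun_prop
  exact (measurableSet_lt measurable_const measurable_fst).inter
    (isClosed_le h1 continuous_const).measurableSet

/-- The characteristic derivatives `A = V_u`, `B = V_v` of `V(u, v) = W(t, x)` satisfy
`A_v = B_u = P W / (4t) - (A + B) / (8 t^{3/2})`. -/
lemma fderiv_fderiv_comp_ofCharCoord {W : ℝ × ℝ → ℝ} (hW : ContDiff ℝ ∞ W) {z : ℝ × ℝ}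
    (hz : 0 < z.1 + z.2) :
    fderiv ℝ (fun y => fderiv ℝ (W ∘ ofCharCoord) y (1, 0)) z (0, 1) =
      tricomiOp W (ofCharCoord z) / (4 * (ofCharCoord z).1) -
        √(ofCharCoord z).1 / (8 * (ofCharCoord z).1 ^ 2) *
          (fderiv ℝ (W ∘ ofCharCoord) z (1, 0) + fderiv ℝ (W ∘ ofCharCoord) z (0, 1)) := by
  have hd := hW.differentiable (by simp)
  have hTd := (contDiff_partialT hW).differentiable (by simp)
  have hXd := (contDiff_partialX hW).differentiable (by simp)
  have hev : ∀ᶠ y : ℝ × ℝ in nhds z, 0 < y.1 + y.2 :=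
    (continuous_fst.add continuous_snd).continuousAt.eventually (lt_mem_nhds hz)
  have hA : (fun y => fderiv ℝ (W ∘ ofCharCoord) y (1, 0)) =ᶠ[nhds z] fun y =>
      (√(ofCharCoord y).1)⁻¹ * (1 / 2) * (partialT W ∘ ofCharCoord) y +
        1 / 2 * (partialX W ∘ ofCharCoord) y := by
    filter_upwards [hev] with y hy
    rw [fderiv_comp_ofCharCoord hd hy]
    simp
  have ht : 0 < (ofCharCoord z).1 := tricomiTime_pos (by linarith)
  have hline : HasDerivAt (fun v => ((z.1, v) : ℝ × ℝ)) (0, 1) z.2 :=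
    (hasDerivAt_const z.2 z.1).prodMk (hasDerivAt_id z.2)
  have hσ : HasDerivAt (fun v => (√(ofCharCoord (z.1, v)).1)⁻¹)
      (-(1 / (4 * (ofCharCoord z).1 ^ 2))) z.2 := by
    have hz2 : 0 < (z.1 + z.2) / 2 := by linarith
    have hT := HasDerivAt.comp (h := fun v : ℝ => (z.1 + v) / 2) z.2
      (hasDerivAt_tricomiTime hz2) (((hasDerivAt_id' z.2).const_add z.1).div_const 2)
    have h := (hT.sqrt ht.ne').fun_inv (by positivity)
    convert! h using 1
    change 0 < tricomiTime ((z.1 + z.2) / 2) at ht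
    simp only [ofCharCoord, Function.comp_apply]
    set t := tricomiTime ((z.1 + z.2) / 2)
    have hs : √t ^ 2 = t := Real.sq_sqrt ht.le
    have hs0 : 0 < √t := by positivity
    rw [← hs]
    simp only [Real.sqrt_sq hs0.le]
    field_simp
    norm_num
  have hP : ∀ f : ℝ × ℝ → ℝ, Differentiable ℝ f → HasDerivAt (fun v => (f ∘ ofCharCoord) (z.1, v))
      ((√(ofCharCoord z).1)⁻¹ * (1 / 2) * partialT f (ofCharCoord z) -
        1 / 2 * partialX f (ofCharCoord z)) z.2 := by
    intro f hf
    have h := ((hf (ofCharCoord z)).comp z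
      ((contDiffAt_ofCharCoord hz).differentiableAt (by simp))).hasFDerivAt.comp_hasDerivAt z.2 hline
    convert! h using 1
    rw [fderiv_comp_ofCharCoord hf hz]
    ring
  have hAd : DifferentiableAt ℝ (fun y => fderiv ℝ (W ∘ ofCharCoord) y (1, 0)) z :=
    (((hW.contDiffAt.comp z (contDiffAt_ofCharCoord hz)).fderiv_right (m := 1)
      (WithTop.coe_le_coe.2 le_top)).differentiableAt (by simp)).clm_apply
      (differentiableAt_const _)
  have h1 := hAd.hasFDerivAt.comp_hasDerivAt z.2 hline
  have h2 := (((hσ.mul_const (1 / 2)).fun_mul (hP _ hTd)).fun_add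
    ((hP _ hXd).const_mul (1 / 2))).congr_of_eventuallyEq
    (f₁ := fun v => fderiv ℝ (W ∘ ofCharCoord) (z.1, v) (1, 0))
    (hline.continuousAt.eventually hA)
  have h3 := h1.unique h2
  rw [h3, fderiv_comp_ofCharCoord hd hz, fderiv_comp_ofCharCoord hd hz, tricomiOp_eq_partial hW,
    partialT_partialX hW]
  simp only [Function.comp_apply, Prod.mk.eta]
  set t := (ofCharCoord z).1
  have hs : √t ^ 2 = t := Real.sq_sqrt ht.le
  have hs0 : 0 < √t := by positivity
  rw [← hs]
  simp only [Real.sqrt_sq hs0.le]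
  field_simp
  ring

/-- Change of variables to characteristic coordinates, in which the cone is a triangle. -/
lemma setLIntegral_charCoord (c x₀ : ℝ) (h : ℝ × ℝ → ℝ≥0∞) :
    ∫⁻ z in {z : ℝ × ℝ | 0 < z.1 + z.2 ∧ z.1 ≤ c + x₀ ∧ z.2 ≤ c - x₀}, h (ofCharCoord z) =
      ∫⁻ z in tricomiCone c x₀, ENNReal.ofReal (2 * √z.1) * h z := by
  set f : ℝ × ℝ → ℝ × ℝ := fun z => (tricomiPhi z.1 + z.2, tricomiPhi z.1 - z.2)
  have hinv : ∀ z : ℝ × ℝ, 0 < z.1 → ofCharCoord (f z) = z := by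
    intro z hz
    simp only [f, ofCharCoord]
    ext
    · simp only
      rw [show (tricomiPhi z.1 + z.2 + (tricomiPhi z.1 - z.2)) / 2 = tricomiPhi z.1 by ring,
        tricomiTime_tricomiPhi hz.le]
    · simp only; ring
  have himg : f '' tricomiCone c x₀ =
      {z : ℝ × ℝ | 0 < z.1 + z.2 ∧ z.1 ≤ c + x₀ ∧ z.2 ≤ c - x₀} := by
    ext z
    constructor
    · rintro ⟨y, ⟨hy0, hy⟩, rfl⟩
      have h1 := tricomiPhi_pos hy0
      have h2 := le_abs_self (y.2 - x₀)
      have h3 := neg_abs_le (y.2 - x₀)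
      refine ⟨?_, ?_, ?_⟩ <;> simp only [f] <;> linarith
    · rintro ⟨h1, h2, h3⟩
      have hT : 0 < (z.1 + z.2) / 2 := by linarith
      refine ⟨ofCharCoord z, ⟨tricomiTime_pos hT, ?_⟩, ?_⟩
      · simp only [ofCharCoord]
        rw [tricomiPhi_tricomiTime hT.le]
        have : |(z.1 - z.2) / 2 - x₀| ≤ c - (z.1 + z.2) / 2 := by
          rw [abs_le]; constructor <;> linarith
        linarith
      · simp only [f, ofCharCoord]
        rw [tricomiPhi_tricomiTime hT.le]
        ext <;> simp only <;> ring
  have hd : ∀ z : ℝ × ℝ, HasFDerivAt f (LinearMap.toContinuousLinearMap (Matrix.toLin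
      (.finTwoProd ℝ) (.finTwoProd ℝ) !![√z.1, 1; √z.1, -1])) z := by
    intro z
    rw [Matrix.toLin_finTwoProd_toContinuousLinearMap]
    have h1 := (hasDerivAt_tricomiPhi z.1).comp_hasFDerivAt z (hasFDerivAt_fst (𝕜 := ℝ) (p := z))
    convert! (h1.add (hasFDerivAt_snd (𝕜 := ℝ) (p := z))).prodMk
      (h1.sub (hasFDerivAt_snd (𝕜 := ℝ) (p := z))) using 2 <;>
      simp [sub_eq_add_neg, neg_one_smul ℝ (ContinuousLinearMap.snd ℝ ℝ ℝ)]
  rw [← himg, lintegral_image_eq_lintegral_abs_det_fderiv_mul volume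
    (measurableSet_tricomiCone c x₀) (fun z _ => (hd z).hasFDerivWithinAt)
    (fun y hy z hz hyz => by rw [← hinv y hy.1, ← hinv z hz.1, hyz])]
  refine setLIntegral_congr_fun (measurableSet_tricomiCone c x₀) fun z hz => ?_
  rw [hinv z hz.1, LinearMap.det_toContinuousLinearMap, LinearMap.det_toLin, Matrix.det_fin_two_of]
  congr 2
  rw [show √z.1 * -1 - 1 * √z.1 = -(2 * √z.1) by ring, abs_neg, abs_of_nonneg (by positivity)]

/-- The pointwise bound for smooth functions vanishing near `t ≤ 0`. Along the two sides of the cone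
that meet at the apex, `W(t₀, x₀)` is the integral of `A` and also that of `B`, and the `L¹` estimate
for the characteristic system bounds the sum of the two. -/
theorem enorm_le_lintegral_tricomiCone {W : ℝ × ℝ → ℝ} (hW : ContDiff ℝ ∞ W) {ε : ℝ} (hε : 0 < ε)
    (h0 : ∀ z : ℝ × ℝ, z.1 ≤ ε → W z = 0) {t₀ : ℝ} (ht₀ : 0 < t₀) (x₀ : ℝ) :
    ‖W (t₀, x₀)‖ₑ ≤ 1 / 2 * ∫⁻ z in tricomiCone (tricomiPhi t₀) x₀,
      ENNReal.ofReal (z.1 ^ (-(1 / 2) : ℝ)) * ‖tricomiOp W z‖ₑ := by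
  set V := W ∘ ofCharCoord
  have hV : ContDiff ℝ ∞ V := contDiff_comp_ofCharCoord hW hε h0
  set A : ℝ × ℝ → ℝ := partialT V
  set B : ℝ × ℝ → ℝ := partialX V
  have hA : ContDiff ℝ ∞ A := contDiff_partialT hV
  have hB : ContDiff ℝ ∞ B := contDiff_partialX hV
  have hV0 : ∀ z : ℝ × ℝ, z.1 + z.2 ≤ 0 → V =ᶠ[nhds z] fun _ => 0 := by
    intro z hz
    have h1 : (ofCharCoord z).1 < ε := by
      rw [ofCharCoord, tricomiTime_of_nonpos (by linarith)]; exact hε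
    have h2 : ∀ᶠ y in nhds z, (ofCharCoord y).1 < ε :=
      (continuous_fst.comp continuous_ofCharCoord).continuousAt.eventually_lt
        continuousAt_const h1
    filter_upwards [h2] with y hy using h0 _ hy.le
  have hdV0 : ∀ z : ℝ × ℝ, z.1 + z.2 ≤ 0 → fderiv ℝ V =ᶠ[nhds z] fun _ => 0 := by
    intro z hz
    have := (hV0 z hz).fderiv (𝕜 := ℝ)
    simp only [fderiv_fun_const] at this
    exact this
  have hA0 : ∀ z : ℝ × ℝ, z.1 + z.2 ≤ 0 → A =ᶠ[nhds z] fun _ => 0 := fun z hz => by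
    filter_upwards [hdV0 z hz] with y hy using by simp [A, partialT, hy]
  have hB0 : ∀ z : ℝ × ℝ, z.1 + z.2 ≤ 0 → B =ᶠ[nhds z] fun _ => 0 := fun z hz => by
    filter_upwards [hdV0 z hz] with y hy using by simp [B, partialX, hy]
  set S : Set (ℝ × ℝ) := {z | 0 < z.1 + z.2}
  set g : ℝ × ℝ → ℝ :=
    S.indicator fun z => tricomiOp W (ofCharCoord z) / (4 * (ofCharCoord z).1)
  set m : ℝ × ℝ → ℝ := fun z => √(ofCharCoord z).1 / (8 * (ofCharCoord z).1 ^ 2)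
  have hAv : ∀ z, fderiv ℝ A z (0, 1) = g z - m z * (A z + B z) := by
    intro z
    by_cases hz : 0 < z.1 + z.2
    · simp only [g, Set.indicator_of_mem (show z ∈ S from hz)]
      exact fderiv_fderiv_comp_ofCharCoord hW hz
    · simp only [g, Set.indicator_of_notMem (show z ∉ S from hz)]
      rw [(hA0 z (not_lt.1 hz)).fderiv_eq, (hA0 z (not_lt.1 hz)).eq_of_nhds,
        (hB0 z (not_lt.1 hz)).eq_of_nhds]
      simp
  have hBu : ∀ z, fderiv ℝ B z (1, 0) = g z - m z * (A z + B z) := fun z => by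
    rw [← hAv]
    exact fderiv_fderiv_apply_comm hV z _ _
  set c := tricomiPhi t₀
  have hc : 0 < c := tricomiPhi_pos ht₀
  have key := integral_abs_add_integral_abs_le (hA.of_le (by simp)) (hB.of_le (by simp))
    (fun z => by positivity) hAv hBu
    (a₁ := -(c - x₀)) (b₁ := c + x₀) (a₂ := -(c + x₀)) (b₂ := c - x₀) (by linarith) (by linarith)
    (fun u hu => (hA0 (u, -(c + x₀)) (by simp only; linarith)).eq_of_nhds)
    (fun v hv => (hB0 (-(c - x₀), v) (by simp only; linarith)).eq_of_nhds)
  have hapex : V (c + x₀, c - x₀) = W (t₀, x₀) := by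
    simp only [V, Function.comp_apply, ofCharCoord]
    rw [show (c + x₀ + (c - x₀)) / 2 = c by ring, tricomiTime_tricomiPhi ht₀.le,
      show (c + x₀ - (c - x₀)) / 2 = x₀ by ring]
  have hdV := hV.differentiable (by simp)
  have hWA : |W (t₀, x₀)| ≤ ∫ u in (-(c - x₀))..(c + x₀), |A (u, c - x₀)| := by
    have h1 : ∫ u in (-(c - x₀))..(c + x₀), A (u, c - x₀) = W (t₀, x₀) := by
      rw [intervalIntegral.integral_eq_sub_of_hasDerivAt (f := fun u => V (u, c - x₀))
        (fun u _ => hasDerivAt_fst_slice hdV (u, c - x₀))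
        (Continuous.intervalIntegrable (hA.continuous.comp (by fun_prop)) _ _), hapex,
        (hV0 (-(c - x₀), c - x₀) (by simp)).eq_of_nhds, sub_zero]
    rw [← h1]
    exact intervalIntegral.abs_integral_le_integral_abs (by linarith)
  have hWB : |W (t₀, x₀)| ≤ ∫ v in (-(c + x₀))..(c - x₀), |B (c + x₀, v)| := by
    have h1 : ∫ v in (-(c + x₀))..(c - x₀), B (c + x₀, v) = W (t₀, x₀) := by
      rw [intervalIntegral.integral_eq_sub_of_hasDerivAt (f := fun v => V (c + x₀, v))
        (fun v _ => hasDerivAt_snd_slice hdV (c + x₀, v))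
        (Continuous.intervalIntegrable (hB.continuous.comp (by fun_prop)) _ _), hapex,
        (hV0 (c + x₀, -(c + x₀)) (by simp)).eq_of_nhds, sub_zero]
    rw [← h1]
    exact intervalIntegral.abs_integral_le_integral_abs (by linarith)
  have h2 : 2 * ‖W (t₀, x₀)‖ₑ ≤
      2 * ∫⁻ z in Icc (-(c - x₀)) (c + x₀) ×ˢ Icc (-(c + x₀)) (c - x₀), ‖g z‖ₑ := by
    refine le_trans ?_ key
    rw [← ofReal_norm, Real.norm_eq_abs,
      show (2 : ℝ≥0∞) = ENNReal.ofReal 2 by simp, ← ENNReal.ofReal_mul (by norm_num)]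
    exact ENNReal.ofReal_le_ofReal (by linarith)
  have h3 : ‖W (t₀, x₀)‖ₑ ≤
      ∫⁻ z in Icc (-(c - x₀)) (c + x₀) ×ˢ Icc (-(c + x₀)) (c - x₀), ‖g z‖ₑ :=
    (ENNReal.mul_le_mul_iff_right (by simp) (by simp)).1 h2
  have hS : MeasurableSet S :=
    measurableSet_lt measurable_const (measurable_fst.add measurable_snd)
  have hset : Icc (-(c - x₀)) (c + x₀) ×ˢ Icc (-(c + x₀)) (c - x₀) ∩ S =
      {z : ℝ × ℝ | 0 < z.1 + z.2 ∧ z.1 ≤ c + x₀ ∧ z.2 ≤ c - x₀} := by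
    ext z
    constructor
    · rintro ⟨⟨h1, h2⟩, h3⟩
      exact ⟨h3, h1.2, h2.2⟩
    · rintro ⟨h1, h2, h3⟩
      exact ⟨⟨⟨by linarith, h2⟩, ⟨by linarith, h3⟩⟩, h1⟩
  refine h3.trans (le_of_eq ?_)
  calc ∫⁻ z in Icc (-(c - x₀)) (c + x₀) ×ˢ Icc (-(c + x₀)) (c - x₀), ‖g z‖ₑ
      = ∫⁻ z in Icc (-(c - x₀)) (c + x₀) ×ˢ Icc (-(c + x₀)) (c - x₀),
          S.indicator (fun z => (fun y : ℝ × ℝ => ‖tricomiOp W y / (4 * y.1)‖ₑ) (ofCharCoord z)) z := by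
        refine lintegral_congr fun z => ?_
        simp only [g]
        rw [enorm_indicator_eq_indicator_enorm]
    _ = ∫⁻ z in tricomiCone c x₀, ENNReal.ofReal (2 * √z.1) *
          ‖tricomiOp W z / (4 * z.1)‖ₑ := by
        rw [setLIntegral_indicator hS, inter_comm, hset]
        exact setLIntegral_charCoord c x₀ fun y => ‖tricomiOp W y / (4 * y.1)‖ₑ
    _ = ∫⁻ z in tricomiCone c x₀, 1 / 2 * (ENNReal.ofReal (z.1 ^ (-(1 / 2) : ℝ)) *
          ‖tricomiOp W z‖ₑ) := by
        refine setLIntegral_congr_fun (measurableSet_tricomiCone c x₀) fun z hz => ?_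
        have ht : 0 < z.1 := hz.1
        have hs : √z.1 ^ 2 = z.1 := Real.sq_sqrt ht.le
        have hs0 : 0 < √z.1 := by positivity
        have e : (1 / 2 : ℝ≥0∞) = ENNReal.ofReal (1 / 2) := by
          rw [ENNReal.ofReal_div_of_pos (by norm_num)]; simp
        rw [← ofReal_norm, ← ofReal_norm, e, ← ENNReal.ofReal_mul (by positivity),
          ← ENNReal.ofReal_mul (by positivity), ← ENNReal.ofReal_mul (by positivity), norm_div,
          Real.norm_of_nonneg (show 0 ≤ 4 * z.1 by positivity), Real.rpow_neg ht.le,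
          ← Real.sqrt_eq_rpow]
        congr 1
        rw [← hs]
        simp only [Real.sqrt_sq hs0.le]
        field_simp
        norm_num
        ring
    _ = _ := lintegral_const_mul' _ _ (by simp)

/-! ### Mollification of weak solutions -/

/-- Extension by zero to `t ≤ 0`. -/
noncomputable def zeroExt (f : ℝ × ℝ → ℝ) : ℝ × ℝ → ℝ := {z : ℝ × ℝ | 0 < z.1}.indicator f

lemma measurableSet_halfPlane : MeasurableSet {z : ℝ × ℝ | 0 < z.1} :=
  measurableSet_lt measurable_const measurable_fst

lemma isClosed_halfPlane : IsClosed {z : ℝ × ℝ | 0 ≤ z.1} :=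
  isClosed_le continuous_const continuous_fst

lemma locallyIntegrable_zeroExt {f : ℝ × ℝ → ℝ}
    (hf : LocallyIntegrableOn f {z : ℝ × ℝ | 0 ≤ z.1} volume) :
    LocallyIntegrable (zeroExt f) volume := by
  rw [locallyIntegrable_iff]
  intro K hK
  rw [zeroExt, integrableOn_indicator_iff measurableSet_halfPlane]
  exact ((locallyIntegrableOn_iff isClosed_halfPlane.isLocallyClosed).1 hf _ inter_subset_left
    (hK.inter_left isClosed_halfPlane)).mono_set
      (inter_subset_inter_left _ fun z (hz : 0 < z.1) => hz.le)

lemma integral_zeroExt_mul (f g : ℝ × ℝ → ℝ) :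
    ∫ z, f z * g z ∂halfPlaneMeasure = ∫ z, zeroExt f z * g z := by
  rw [halfPlaneMeasure, ← integral_indicator measurableSet_halfPlane]
  congr 1 with z
  by_cases hz : 0 < z.1
  · rw [zeroExt, Set.indicator_of_mem (by exact hz), Set.indicator_of_mem (by exact hz)]
  · rw [zeroExt, Set.indicator_of_notMem (by exact hz), Set.indicator_of_notMem (by exact hz),
      zero_mul]

/-- The convolution of `f` with the kernel `k`. -/
noncomputable def mollify (k f : ℝ × ℝ → ℝ) (z : ℝ × ℝ) : ℝ := ∫ y, f y * k (z - y)

lemma mollify_eq_convolution (k f : ℝ × ℝ → ℝ) :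
    mollify k f = convolution f k (ContinuousLinearMap.lsmul ℝ ℝ) volume := rfl

lemma mollify_eq_convolution_swap (k f : ℝ × ℝ → ℝ) :
    mollify k f = convolution k f (ContinuousLinearMap.lsmul ℝ ℝ) volume := by
  ext z
  rw [convolution_lsmul_swap]
  simp only [mollify, smul_eq_mul, mul_comm]

lemma contDiff_mollify {k f : ℝ × ℝ → ℝ} (hk : ContDiff ℝ ∞ k) (hkc : HasCompactSupport k)
    (hf : LocallyIntegrable f volume) : ContDiff ℝ ∞ (mollify k f) := by
  rw [mollify_eq_convolution]
  exact hkc.contDiff_convolution_right _ hf hk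

lemma integrable_mul_kernel {k f : ℝ × ℝ → ℝ} (hk : Continuous k) (hkc : HasCompactSupport k)
    (hf : LocallyIntegrable f volume) (z : ℝ × ℝ) : Integrable fun y => f y * k (z - y) := by
  have := hkc.convolutionExists_right (ContinuousLinearMap.lsmul ℝ ℝ) hf hk z
  exact this

lemma fderiv_mollify_apply {k f : ℝ × ℝ → ℝ} (hk : ContDiff ℝ ∞ k) (hkc : HasCompactSupport k)
    (hf : LocallyIntegrable f volume) (z e : ℝ × ℝ) :
    fderiv ℝ (mollify k f) z e = mollify (fun y => fderiv ℝ k y e) f z := by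
  rw [mollify_eq_convolution, mollify_eq_convolution,
    (hkc.hasFDerivAt_convolution_right (ContinuousLinearMap.lsmul ℝ ℝ) hf
      (hk.of_le (by simp)) z).fderiv]
  exact convolution_precompR_apply _ hf (hkc.fderiv ℝ) (hk.continuous_fderiv (by simp)) z e

lemma hasCompactSupport_partialT {k : ℝ × ℝ → ℝ} (hkc : HasCompactSupport k) :
    HasCompactSupport (partialT k) :=
  hkc.fderiv_apply ℝ (1, 0)

lemma hasCompactSupport_partialX {k : ℝ × ℝ → ℝ} (hkc : HasCompactSupport k) :
    HasCompactSupport (partialX k) :=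
  hkc.fderiv_apply ℝ (0, 1)

lemma partialT_mollify {k f : ℝ × ℝ → ℝ} (hk : ContDiff ℝ ∞ k) (hkc : HasCompactSupport k)
    (hf : LocallyIntegrable f volume) : partialT (mollify k f) = mollify (partialT k) f :=
  funext fun z => fderiv_mollify_apply hk hkc hf z _

lemma partialX_mollify {k f : ℝ × ℝ → ℝ} (hk : ContDiff ℝ ∞ k) (hkc : HasCompactSupport k)
    (hf : LocallyIntegrable f volume) : partialX (mollify k f) = mollify (partialX k) f :=
  funext fun z => fderiv_mollify_apply hk hkc hf z _

lemma fderiv_comp_const_sub_apply {k : ℝ × ℝ → ℝ} (hk : Differentiable ℝ k) (z y e : ℝ × ℝ) :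
    fderiv ℝ (fun y => k (z - y)) y e = -fderiv ℝ k (z - y) e := by
  have h := (hk (z - y)).hasFDerivAt.comp y ((hasFDerivAt_id y).const_sub z)
  have h2 : HasFDerivAt (fun y => k (z - y)) _ y := h
  rw [h2.fderiv]
  simp

/-- The mollified solution solves the equation with right-hand side the mollified one, up to a
commutator that comes from the variable coefficient `t`. -/
lemma tricomiOp_mollify {w F : ℝ × ℝ → ℝ} (h : IsWeakTricomiSolution w F) {k : ℝ × ℝ → ℝ}
    (hk : ContDiff ℝ ∞ k) (hkc : HasCompactSupport k) (z : ℝ × ℝ) :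
    tricomiOp (mollify k (zeroExt w)) z =
      mollify k (zeroExt F) z - mollify (fun y => y.1 * partialX (partialX k) y) (zeroExt w) z := by
  have hw := locallyIntegrable_zeroExt h.locallyIntegrable_sol
  have hT := contDiff_partialT hk
  have hX := contDiff_partialX hk
  have hXX := contDiff_partialX hX
  have hTT := contDiff_partialT hT
  have hTc := hasCompactSupport_partialT hkc
  have hXc := hasCompactSupport_partialX hkc
  have hTTc := hasCompactSupport_partialT hTc
  have hXXc := hasCompactSupport_partialX hXc
  rw [tricomiOp_eq_partial (contDiff_mollify hk hkc hw), partialT_mollify hk hkc hw,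
    partialT_mollify hT hTc hw, partialX_mollify hk hkc hw, partialX_mollify hX hXc hw]
  have hψ : ContDiff ℝ ∞ fun y => k (z - y) := hk.comp (contDiff_const.sub contDiff_id)
  have hψc : HasCompactSupport fun y => k (z - y) := hkc.comp_homeomorph (Homeomorph.subLeft z)
  have hweak := h.weak_eq _ hψ hψc
  rw [integral_zeroExt_mul, integral_zeroExt_mul] at hweak
  have e1 : partialT (fun y => k (z - y)) = fun y => -partialT k (z - y) :=
    funext fun y => fderiv_comp_const_sub_apply (hk.differentiable (by simp)) z y _
  have e2 : partialX (fun y => k (z - y)) = fun y => -partialX k (z - y) :=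
    funext fun y => fderiv_comp_const_sub_apply (hk.differentiable (by simp)) z y _
  have hop : ∀ y, tricomiOp (fun y => k (z - y)) y =
      partialT (partialT k) (z - y) - y.1 * partialX (partialX k) (z - y) := by
    intro y
    rw [tricomiOp_eq_partial hψ, e1, e2]
    congr 1
    · change fderiv ℝ (fun y => -partialT k (z - y)) y (1, 0) = _
      rw [fderiv_fun_neg, neg_apply,
        fderiv_comp_const_sub_apply (hT.differentiable (by simp)), neg_neg]
      rfl
    · congr 1
      change fderiv ℝ (fun y => -partialX k (z - y)) y (0, 1) = _
      rw [fderiv_fun_neg, neg_apply,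
        fderiv_comp_const_sub_apply (hX.differentiable (by simp)), neg_neg]
      rfl
  simp only [hop] at hweak
  have hCc : HasCompactSupport fun y : ℝ × ℝ => y.1 * partialX (partialX k) y := hXXc.mul_left
  have hCcont : Continuous fun y : ℝ × ℝ => y.1 * partialX (partialX k) y :=
    continuous_fst.mul hXX.continuous
  simp only [mollify]
  rw [← hweak, ← integral_const_mul, ← integral_sub (integrable_mul_kernel hTT.continuous hTTc hw z)
    ((integrable_mul_kernel hXX.continuous hXXc hw z).const_mul _), ← integral_sub]
  · congr 1 with y
    simp only [Prod.fst_sub]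
    ring
  · refine ((integrable_mul_kernel hTT.continuous hTTc hw z).sub
      (((integrable_mul_kernel hXX.continuous hXXc hw z).const_mul z.1).sub
        (integrable_mul_kernel hCcont hCc hw z))).congr (Filter.Eventually.of_forall fun y => ?_)
    simp only [Pi.sub_apply, Prod.fst_sub]
    ring
  · exact integrable_mul_kernel hCcont hCc hw z

lemma enorm_mollify_le (k f : ℝ × ℝ → ℝ) (z : ℝ × ℝ) :
    ‖mollify k f z‖ₑ ≤ ∫⁻ y, ‖k (z - y)‖ₑ * ‖f y‖ₑ := by
  refine (enorm_integral_le_lintegral_enorm _).trans (lintegral_mono fun y => ?_)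
  rw [enorm_mul, mul_comm]

/-- Tonelli for a kernel that moves mass forward in time and by at most `ε` in space: the cone only
has to be enlarged by `ε`, and the weight `a` at the new point is bounded by `b` at the old one. -/
lemma setLIntegral_tricomiCone_kernel_le {κ f : ℝ × ℝ → ℝ≥0∞} {a b : ℝ × ℝ → ℝ≥0∞}
    (hκ : Measurable κ) (hf : AEMeasurable f volume) (hb : Measurable b)
    (hf0 : ∀ y : ℝ × ℝ, y.1 ≤ 0 → f y = 0) {ε c x₀ : ℝ}
    (hκs : ∀ y, κ y ≠ 0 → 0 < y.1 ∧ |y.2| ≤ ε)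
    (hab : ∀ z y : ℝ × ℝ, 0 < y.1 → κ (z - y) ≠ 0 → a z ≤ b y) :
    ∫⁻ z in tricomiCone c x₀, a z * ∫⁻ y, κ (z - y) * f y ≤
      (∫⁻ y, κ y) * ∫⁻ y in tricomiCone (c + ε) x₀, b y * f y := by
  have hD := measurableSet_tricomiCone (c + ε) x₀
  set g : ℝ × ℝ → ℝ≥0∞ := (tricomiCone (c + ε) x₀).indicator fun y => b y * f y
  have hg : AEMeasurable g volume := (hb.aemeasurable.mul hf).indicator hD
  calc ∫⁻ z in tricomiCone c x₀, a z * ∫⁻ y, κ (z - y) * f y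
      ≤ ∫⁻ z in tricomiCone c x₀, ∫⁻ y, κ (z - y) * g y := by
        refine setLIntegral_mono_ae' (measurableSet_tricomiCone c x₀)
          (Filter.Eventually.of_forall fun z hz => ?_)
        have hmeas : AEMeasurable (fun y => κ (z - y) * f y) volume :=
          (hκ.comp (measurable_const.sub measurable_id)).aemeasurable.mul hf
        rw [← lintegral_const_mul'' _ hmeas]
        refine lintegral_mono fun y => ?_
        rcases le_or_gt y.1 0 with hy | hy
        · simp [hf0 y hy]
        by_cases hk0 : κ (z - y) = 0
        · simp [hk0]
        obtain ⟨h1, h2⟩ := hκs _ hk0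
        have hmem : y ∈ tricomiCone (c + ε) x₀ := by
          refine ⟨hy, ?_⟩
          have h3 : tricomiPhi y.1 ≤ tricomiPhi z.1 :=
            strictMonoOn_tricomiPhi.monotoneOn hy.le hz.1.le (by simpa using h1.le)
          have h4 : |y.2 - x₀| ≤ |z.2 - x₀| + |(z - y).2| := by
            have := abs_sub_le y.2 z.2 x₀
            rw [Prod.snd_sub, abs_sub_comm z.2 y.2]
            linarith
          linarith [hz.2]
        simp only [g, Set.indicator_of_mem hmem]
        calc a z * (κ (z - y) * f y) = κ (z - y) * (a z * f y) := by ring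
          _ ≤ κ (z - y) * (b y * f y) := by gcongr; exact hab z y hy hk0
    _ ≤ ∫⁻ z, ∫⁻ y, κ (z - y) * g y := setLIntegral_le_lintegral _ _
    _ = ∫⁻ y, ∫⁻ z, κ (z - y) * g y := by
        refine lintegral_lintegral_swap ?_
        exact (hκ.comp (measurable_fst.sub measurable_snd)).aemeasurable.mul
          (hg.comp_quasiMeasurePreserving Measure.quasiMeasurePreserving_snd)
    _ = ∫⁻ y, (∫⁻ y, κ y) * g y := by
        refine lintegral_congr fun y => ?_
        have hm : Measurable fun z => κ (z - y) := hκ.comp (measurable_id.sub measurable_const)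
        rw [lintegral_mul_const _ hm,
          lintegral_sub_right_eq_self κ y]
    _ = (∫⁻ y, κ y) * ∫⁻ y, g y := lintegral_const_mul'' _ hg
    _ = _ := by rw [lintegral_indicator hD]

/-- A mollifier with support in `{0 < t, |x| ≤ ε}` whose commutator with the Tricomi operator is
small. The support in time stays away from `0` by `τ`, and the factor `τ^{-1/2}` in
`commutator_le` is the largest value of the weight `s^{-1/2}` that the commutator can meet. -/
structure IsForwardMollifier (ε τ : ℝ) (k : ℝ × ℝ → ℝ) : Prop where
  pos : 0 < τ
  contDiff : ContDiff ℝ ∞ k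
  hasCompactSupport : HasCompactSupport k
  nonneg : ∀ y, 0 ≤ k y
  integral_eq_one : ∫ y, k y = 1
  support : ∀ y, k y ≠ 0 → τ < y.1 ∧ y.1 ≤ ε ∧ |y.2| ≤ ε
  support_partialX : ∀ y, partialX (partialX k) y ≠ 0 → τ < y.1 ∧ |y.2| ≤ ε
  commutator_le : ENNReal.ofReal (τ ^ (-(1 / 2) : ℝ)) *
    ∫⁻ y : ℝ × ℝ, ‖y.1 * partialX (partialX k) y‖ₑ ≤ ENNReal.ofReal ε

lemma lintegral_enorm_eq_one {α : Type*} [MeasurableSpace α] {μ : Measure α} {f : α → ℝ}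
    (h0 : ∀ x, 0 ≤ f x) (h1 : ∫ x, f x ∂μ = 1) : ∫⁻ x, ‖f x‖ₑ ∂μ = 1 := by
  rw [← ofReal_integral_norm_eq_lintegral_enorm (integrable_of_integral_eq_one h1),
    integral_congr_ae (Filter.Eventually.of_forall fun x => Real.norm_of_nonneg (h0 x)), h1,
    ENNReal.ofReal_one]

/-- The commutator of `η_τ(t) χ_ε(x)` is at most `2 τ ‖χ_ε''‖₁`, so `√τ ‖χ_ε''‖₁` has to be small:
the time scale is chosen after the space scale. -/
lemma exists_isForwardMollifier {ε : ℝ} (hε : 0 < ε) : ∃ τ k, IsForwardMollifier ε τ k := by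
  let bχ : ContDiffBump (0 : ℝ) := ⟨ε / 2, ε, by positivity, by linarith⟩
  set χ : ℝ → ℝ := bχ.normed volume
  have hχ : ContDiff ℝ ∞ χ := bχ.contDiff_normed
  have hχc : HasCompactSupport χ := bχ.hasCompactSupport_normed
  have hχ1 : ContDiff ℝ ∞ (deriv χ) := (contDiff_infty_iff_deriv.1 hχ).2
  have hχ2 : ContDiff ℝ ∞ (deriv (deriv χ)) := (contDiff_infty_iff_deriv.1 hχ1).2
  have hN : ∫⁻ x, ‖deriv (deriv χ) x‖ₑ ≠ ⊤ :=
    (hχ2.continuous.integrable_of_hasCompactSupport hχc.deriv.deriv).2.ne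
  set N := ∫⁻ x, ‖deriv (deriv χ) x‖ₑ
  set n := N.toReal
  have hn : 0 ≤ n := ENNReal.toReal_nonneg
  set τ : ℝ := min (ε / 2) ((ε / (2 * (n + 1))) ^ 2)
  have hτ : 0 < τ := lt_min (by positivity) (by positivity)
  have hτε : 2 * τ ≤ ε := by linarith [min_le_left (ε / 2) ((ε / (2 * (n + 1))) ^ 2)]
  have hτn : 2 * √τ * n ≤ ε := by
    have h1 : √τ ≤ ε / (2 * (n + 1)) := Real.sqrt_le_iff.2 ⟨by positivity, min_le_right _ _⟩
    calc 2 * √τ * n ≤ 2 * (ε / (2 * (n + 1))) * (n + 1) := by gcongr; linarith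
      _ = ε := by field_simp
  let bη : ContDiffBump (3 * τ / 2) := ⟨τ / 4, τ / 2, by positivity, by linarith⟩
  set η : ℝ → ℝ := bη.normed volume
  have hη : ContDiff ℝ ∞ η := bη.contDiff_normed
  have hηs : ∀ t, η t ≠ 0 → τ < t ∧ t < 2 * τ := by
    intro t ht
    have h1 : t ∈ Function.support η := ht
    rw [bη.support_normed_eq, Metric.mem_ball, Real.dist_eq, abs_lt] at h1
    have hR : bη.rOut = τ / 2 := rfl
    rw [hR] at h1
    constructor <;> linarith [h1.1, h1.2]
  have hχs : ∀ x, x ∈ tsupport χ → |x| ≤ ε := by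
    intro x hx
    rw [bχ.tsupport_normed_eq, mem_closedBall_zero_iff] at hx
    exact hx
  have hχ2s : ∀ x, deriv (deriv χ) x ≠ 0 → |x| ≤ ε := fun x hx =>
    hχs x (closure_minimal (support_deriv_subset (f := χ)) (isClosed_tsupport χ)
      (support_deriv_subset (f := deriv χ) hx))
  set k : ℝ × ℝ → ℝ := fun y => η y.1 * χ y.2
  have hk : ContDiff ℝ ∞ k := (hη.comp contDiff_fst).mul (hχ.comp contDiff_snd)
  have hX : ∀ θ : ℝ → ℝ, ContDiff ℝ ∞ θ →
      partialX (fun y => η y.1 * θ y.2) = fun y => η y.1 * deriv θ y.2 := by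
    intro θ hθ
    ext y
    have hd : Differentiable ℝ fun y : ℝ × ℝ => η y.1 * θ y.2 :=
      ((hη.comp contDiff_fst).mul (hθ.comp contDiff_snd)).differentiable (by simp)
    exact (hasDerivAt_snd_slice hd y).unique
      (((hθ.differentiable (by simp) y.2).hasDerivAt).const_mul (η y.1))
  have hXX : partialX (partialX k) = fun y => η y.1 * deriv (deriv χ) y.2 := by
    rw [hX χ hχ, hX _ hχ1]
  refine ⟨τ, k, hτ, hk, ?_, fun y => mul_nonneg (bη.nonneg_normed _) (bχ.nonneg_normed _), ?_, ?_,
    ?_, ?_⟩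
  · refine HasCompactSupport.of_support_subset_isCompact
      (bη.hasCompactSupport_normed (μ := volume) |>.isCompact.prod hχc.isCompact) fun y hy => ?_
    exact ⟨subset_tsupport _ (left_ne_zero_of_mul hy), subset_tsupport _ (right_ne_zero_of_mul hy)⟩
  · rw [Measure.volume_eq_prod, integral_prod_mul, bη.integral_normed, bχ.integral_normed, mul_one]
  · intro y hy
    have h1 := hηs _ (left_ne_zero_of_mul hy)
    exact ⟨h1.1, by linarith [h1.2], hχs _ (subset_tsupport _ (right_ne_zero_of_mul hy))⟩
  · intro y hy
    rw [hXX] at hy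
    exact ⟨(hηs _ (left_ne_zero_of_mul hy)).1, hχ2s _ (right_ne_zero_of_mul hy)⟩
  · have hη1 : ∫⁻ t, ‖η t‖ₑ = 1 := lintegral_enorm_eq_one (fun t => bη.nonneg_normed t) bη.integral_normed
    have h1 : ∫⁻ y : ℝ × ℝ, ‖y.1 * partialX (partialX k) y‖ₑ ≤ ENNReal.ofReal (2 * τ) * N := by
      calc ∫⁻ y : ℝ × ℝ, ‖y.1 * partialX (partialX k) y‖ₑ
          ≤ ∫⁻ y : ℝ × ℝ, ENNReal.ofReal (2 * τ) * (‖η y.1‖ₑ * ‖deriv (deriv χ) y.2‖ₑ) := by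
            refine lintegral_mono fun y => ?_
            rw [hXX, ← enorm_mul, enorm_mul]
            by_cases h0 : η y.1 = 0
            · simp [h0]
            have h1 := hηs _ h0
            gcongr
            rw [← ofReal_norm, Real.norm_of_nonneg (by linarith)]
            exact ENNReal.ofReal_le_ofReal h1.2.le
        _ = ENNReal.ofReal (2 * τ) * N := by
            rw [lintegral_const_mul' _ _ ENNReal.ofReal_ne_top, Measure.volume_eq_prod,
              lintegral_prod_mul hη.continuous.enorm.aemeasurable
                hχ2.continuous.enorm.aemeasurable, hη1, one_mul]
    calc ENNReal.ofReal (τ ^ (-(1 / 2) : ℝ)) * ∫⁻ y : ℝ × ℝ, ‖y.1 * partialX (partialX k) y‖ₑ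
        ≤ ENNReal.ofReal (τ ^ (-(1 / 2) : ℝ)) * (ENNReal.ofReal (2 * τ) * N) := by gcongr
      _ = ENNReal.ofReal (2 * √τ * n) := by
          rw [← ENNReal.ofReal_toReal hN, ← ENNReal.ofReal_mul (by positivity),
            ← ENNReal.ofReal_mul (by positivity), Real.rpow_neg hτ.le, ← Real.sqrt_eq_rpow]
          congr 1
          have hs : √τ ^ 2 = τ := Real.sq_sqrt hτ.le
          have hs0 : 0 < √τ := by positivity
          change (√τ)⁻¹ * (2 * τ * n) = 2 * √τ * n
          field_simp
          linear_combination (-n) * hs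
      _ ≤ ENNReal.ofReal ε := ENNReal.ofReal_le_ofReal hτn

lemma aemeasurable_enorm_zeroExt {f : ℝ × ℝ → ℝ}
    (hf : LocallyIntegrableOn f {z : ℝ × ℝ | 0 ≤ z.1} volume) :
    AEMeasurable (fun y => ‖zeroExt f y‖ₑ) volume :=
  (locallyIntegrable_zeroExt hf).aestronglyMeasurable.enorm

lemma zeroExt_of_pos (f : ℝ × ℝ → ℝ) {z : ℝ × ℝ} (hz : 0 < z.1) : zeroExt f z = f z :=
  Set.indicator_of_mem (s := {z : ℝ × ℝ | 0 < z.1}) hz f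

lemma zeroExt_of_nonpos (f : ℝ × ℝ → ℝ) {z : ℝ × ℝ} (hz : z.1 ≤ 0) : zeroExt f z = 0 :=
  Set.indicator_of_notMem (s := {z : ℝ × ℝ | 0 < z.1}) (not_lt.2 hz) f

lemma setLIntegral_tricomiCone_zeroExt (f : ℝ × ℝ → ℝ) (a : ℝ × ℝ → ℝ≥0∞) (c x₀ : ℝ) :
    ∫⁻ y in tricomiCone c x₀, a y * ‖zeroExt f y‖ₑ = ∫⁻ y in tricomiCone c x₀, a y * ‖f y‖ₑ :=
  setLIntegral_congr_fun (measurableSet_tricomiCone c x₀) fun y hy => by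
    simp only [zeroExt_of_pos f hy.1]

/-- The pointwise cone bound for the mollified weak solution. -/
lemma enorm_mollify_zeroExt_le {w F : ℝ × ℝ → ℝ} (h : IsWeakTricomiSolution w F) {ε τ : ℝ}
    {k : ℝ × ℝ → ℝ} (hk : IsForwardMollifier ε τ k) {t₀ : ℝ} (ht₀ : 0 < t₀) (x₀ : ℝ) :
    ‖mollify k (zeroExt w) (t₀, x₀)‖ₑ ≤ 1 / 2 *
      ((∫⁻ y in tricomiCone (tricomiPhi t₀ + ε) x₀,
          ENNReal.ofReal (y.1 ^ (-(1 / 2) : ℝ)) * ‖F y‖ₑ) +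
        ENNReal.ofReal ε * ∫⁻ y in tricomiCone (tricomiPhi t₀ + ε) x₀, ‖w y‖ₑ) := by
  have hw := locallyIntegrable_zeroExt h.locallyIntegrable_sol
  have hτ := hk.pos
  have hzero : ∀ z : ℝ × ℝ, z.1 ≤ τ → mollify k (zeroExt w) z = 0 := by
    intro z hz
    refine integral_eq_zero_of_ae (Filter.Eventually.of_forall fun y => ?_)
    rcases le_or_gt y.1 0 with hy | hy
    · simp [zeroExt_of_nonpos w hy]
    · have : k (z - y) = 0 := by
        by_contra hne
        have h1 := (hk.support _ hne).1
        rw [Prod.fst_sub] at h1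
        linarith
      simp [this]
  refine (enorm_le_lintegral_tricomiCone (contDiff_mollify hk.contDiff hk.hasCompactSupport hw) hτ
    hzero ht₀ x₀).trans ?_
  set κ : ℝ × ℝ → ℝ≥0∞ := fun y => ‖y.1 * partialX (partialX k) y‖ₑ
  have hXX := contDiff_partialX (contDiff_partialX hk.contDiff)
  have hκm : Measurable κ := (continuous_fst.mul hXX.continuous).enorm.measurable
  have hkm : Measurable fun y => ‖k y‖ₑ := hk.contDiff.continuous.enorm.measurable
  have ham : Measurable fun y : ℝ × ℝ => ENNReal.ofReal (y.1 ^ (-(1 / 2) : ℝ)) := by fun_prop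
  have hk1 : ∫⁻ y, ‖k y‖ₑ = 1 := lintegral_enorm_eq_one hk.nonneg hk.integral_eq_one
  have hFm := aemeasurable_enorm_zeroExt h.locallyIntegrable_rhs
  have hwm := aemeasurable_enorm_zeroExt h.locallyIntegrable_sol
  have e1 := setLIntegral_tricomiCone_kernel_le (c := tricomiPhi t₀) (x₀ := x₀) (ε := ε)
    (a := fun y => ENNReal.ofReal (y.1 ^ (-(1 / 2) : ℝ))) hkm hFm ham
    (fun y hy => by simp [zeroExt_of_nonpos F hy])
    (fun y hy => by
      obtain ⟨h1, -, h2⟩ := hk.support y (by simpa using hy)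
      exact ⟨hτ.trans h1, h2⟩)
    (fun z y hy hzy => by
      have h1 := (hk.support (z - y) (by simpa using hzy)).1
      rw [Prod.fst_sub] at h1
      exact ENNReal.ofReal_le_ofReal
        (Real.rpow_le_rpow_of_nonpos hy (by linarith) (by norm_num)))
  have e2 := setLIntegral_tricomiCone_kernel_le (c := tricomiPhi t₀) (x₀ := x₀) (ε := ε)
    (a := fun y => ENNReal.ofReal (y.1 ^ (-(1 / 2) : ℝ)))
    (b := fun _ => ENNReal.ofReal (τ ^ (-(1 / 2) : ℝ))) hκm hwm measurable_const
    (fun y hy => by simp [zeroExt_of_nonpos w hy])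
    (fun y hy => by
      obtain ⟨h1, h2⟩ := hk.support_partialX y fun h0 => hy (by simp [κ, h0])
      exact ⟨hτ.trans h1, h2⟩)
    (fun z y hy hzy => by
      have h1 := (hk.support_partialX (z - y) fun h0 => hzy (by simp only [κ, h0]; simp)).1
      rw [Prod.fst_sub] at h1
      exact ENNReal.ofReal_le_ofReal
        (Real.rpow_le_rpow_of_nonpos hτ (by linarith) (by norm_num)))
  rw [hk1, one_mul, setLIntegral_tricomiCone_zeroExt] at e1
  rw [setLIntegral_tricomiCone_zeroExt, lintegral_const_mul' _ _ ENNReal.ofReal_ne_top,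
    ← mul_assoc, mul_comm (∫⁻ y, κ y)] at e2
  gcongr
  calc ∫⁻ z in tricomiCone (tricomiPhi t₀) x₀, ENNReal.ofReal (z.1 ^ (-(1 / 2) : ℝ)) *
        ‖tricomiOp (mollify k (zeroExt w)) z‖ₑ
      ≤ ∫⁻ z in tricomiCone (tricomiPhi t₀) x₀,
          (ENNReal.ofReal (z.1 ^ (-(1 / 2) : ℝ)) * (∫⁻ y, ‖k (z - y)‖ₑ * ‖zeroExt F y‖ₑ) +
          ENNReal.ofReal (z.1 ^ (-(1 / 2) : ℝ)) * ∫⁻ y, κ (z - y) * ‖zeroExt w y‖ₑ) := by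
        refine lintegral_mono fun z => ?_
        rw [← mul_add, tricomiOp_mollify h hk.contDiff hk.hasCompactSupport]
        gcongr
        exact (enorm_sub_le).trans (add_le_add (enorm_mollify_le _ _ _) (enorm_mollify_le _ _ _))
    _ = (∫⁻ z in tricomiCone (tricomiPhi t₀) x₀,
          ENNReal.ofReal (z.1 ^ (-(1 / 2) : ℝ)) * (∫⁻ y, ‖k (z - y)‖ₑ * ‖zeroExt F y‖ₑ)) +
        ∫⁻ z in tricomiCone (tricomiPhi t₀) x₀,
          ENNReal.ofReal (z.1 ^ (-(1 / 2) : ℝ)) * ∫⁻ y, κ (z - y) * ‖zeroExt w y‖ₑ := by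
        refine lintegral_add_left' ?_ _
        refine ham.aemeasurable.mul (AEMeasurable.restrict ?_)
        exact AEMeasurable.lintegral_prod_right' (f := fun p : (ℝ × ℝ) × (ℝ × ℝ) =>
          ‖k (p.1 - p.2)‖ₑ * ‖zeroExt F p.2‖ₑ)
          ((hkm.comp (measurable_fst.sub measurable_snd)).aemeasurable.mul
          (hFm.comp_quasiMeasurePreserving Measure.quasiMeasurePreserving_snd))
    _ ≤ _ := add_le_add e1 (e2.trans (mul_le_mul_left (hk.commutator_le) _))

/-! ### The cone bound for weak solutions -/

/-- Mollifications commute, by associativity and commutativity of the convolution. -/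
lemma mollify_mollify_comm {f g h : ℝ × ℝ → ℝ} (hf : Continuous f) (hfc : HasCompactSupport f)
    (hg : Continuous g) (hgc : HasCompactSupport g) (hh : LocallyIntegrable h volume) :
    mollify f (mollify g h) = mollify g (mollify f h) := by
  have hhn : LocallyIntegrable (fun x => ‖h x‖) volume := fun x => (hh x).norm
  have key : ∀ f g : ℝ × ℝ → ℝ, Continuous f → HasCompactSupport f → Continuous g →
      HasCompactSupport g → mollify f (mollify g h) = mollify (mollify f g) h := by
    intro f g hf hfc hg hgc
    ext z
    rw [mollify_eq_convolution_swap f, mollify_eq_convolution_swap g h,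
      mollify_eq_convolution_swap _ h, mollify_eq_convolution_swap f g]
    refine (convolution_assoc _ _ _ _ (fun x y z => by simp [mul_assoc]) hf.aestronglyMeasurable
      hg.aestronglyMeasurable hh.aestronglyMeasurable
      (Filter.Eventually.of_forall (hgc.convolutionExists_right _ hf.locallyIntegrable hg))
      (Filter.Eventually.of_forall (hgc.norm.convolutionExists_left _ hg.norm hhn)) ?_).symm
    exact hfc.norm.convolutionExists_left _ hf.norm
      (hgc.norm.continuous_convolution_left _ hg.norm hhn).locallyIntegrable z
  rw [key f g hf hfc hg hgc, key g f hg hgc hf hfc]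
  congr 1
  rw [mollify_eq_convolution, mollify_eq_convolution_swap]

lemma setLIntegral_tricomiCone_lt_top {w : ℝ × ℝ → ℝ}
    (hw : LocallyIntegrableOn w {z : ℝ × ℝ | 0 ≤ z.1} volume) (c x₀ : ℝ) :
    ∫⁻ y in tricomiCone c x₀, ‖w y‖ₑ < ⊤ := by
  have hK : IsCompact (Icc 0 (tricomiTime c) ×ˢ Icc (x₀ - c) (x₀ + c)) :=
    isCompact_Icc.prod isCompact_Icc
  have h1 : IntegrableOn w (Icc 0 (tricomiTime c) ×ˢ Icc (x₀ - c) (x₀ + c)) :=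
    (locallyIntegrableOn_iff isClosed_halfPlane.isLocallyClosed).1 hw _ (fun z hz => hz.1.1) hK
  refine lt_of_le_of_lt (lintegral_mono_set fun z hz => ?_) h1.2
  have hp := tricomiPhi_pos hz.1
  have h2 := hz.2
  have h3 := abs_nonneg (z.2 - x₀)
  have h4 : z.1 ≤ tricomiTime c := by
    rw [← strictMonoOn_tricomiPhi.le_iff_le hz.1.le (tricomiTime_pos (by linarith)).le,
      tricomiPhi_tricomiTime (by linarith)]
    linarith
  have h5 := abs_le.1 (show |z.2 - x₀| ≤ c by linarith)
  exact ⟨⟨hz.1.le, h4⟩, by linarith [h5.1], by linarith [h5.2]⟩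

/-- A weak solution is bounded, at almost every point, by the integral of `s^{-1/2} |F|` over the
backward characteristic cone, slightly enlarged. -/
theorem ae_enorm_le_setLIntegral_tricomiCone {w F : ℝ × ℝ → ℝ} (h : IsWeakTricomiSolution w F) :
    ∀ᵐ z ∂halfPlaneMeasure, ∀ c, tricomiPhi z.1 < c →
      ‖w z‖ₑ ≤ 1 / 2 *
        ∫⁻ y in tricomiCone c z.2, ENNReal.ofReal (y.1 ^ (-(1 / 2) : ℝ)) * ‖F y‖ₑ := by
  have hw := locallyIntegrable_zeroExt h.locallyIntegrable_sol
  have hr : ∀ j : ℕ, (0 : ℝ) < 1 / (j + 1) := fun j => by positivity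
  let φ : ℕ → ContDiffBump (0 : ℝ × ℝ) := fun j =>
    ⟨1 / (j + 1) / 2, 1 / (j + 1), by have := hr j; positivity, by linarith [hr j]⟩
  have hrto : Filter.Tendsto (fun j : ℕ => (1 : ℝ) / (j + 1)) Filter.atTop (nhds 0) :=
    tendsto_one_div_add_atTop_nhds_zero_nat
  have hae := ContDiffBump.ae_convolution_tendsto_right_of_locallyIntegrable (φ := φ) (K := 2)
    (l := Filter.atTop) hrto (Filter.Eventually.of_forall fun j => le_of_eq (by simp [φ]; ring)) hw
  choose τ k hk using fun n : ℕ => exists_isForwardMollifier (hr n)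
  rw [halfPlaneMeasure]
  filter_upwards [ae_restrict_of_ae hae, ae_restrict_mem measurableSet_halfPlane] with z hz hz0
  intro c hc
  replace hz0 : 0 < z.1 := hz0
  rw [zeroExt_of_pos w hz0] at hz
  -- near `z`, cones with a little slack stay inside the given one
  have hsmall : ∀ᶠ j : ℕ in Filter.atTop, ∀ y, ‖y - z‖ < 1 / (j + 1) →
      0 < y.1 ∧ tricomiCone (tricomiPhi y.1 + 1 / (j + 1)) y.2 ⊆ tricomiCone c z.2 := by
    obtain ⟨δ, hδ, hδc⟩ : ∃ δ > 0, tricomiPhi z.1 + δ + 2 * δ ≤ c ∧ δ ≤ z.1 :=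
      ⟨min ((c - tricomiPhi z.1) / 3) z.1, lt_min (by linarith) hz0, by
        linarith [min_le_left ((c - tricomiPhi z.1) / 3) z.1], min_le_right _ _⟩
    obtain ⟨ρ, hρ, hφ⟩ := Metric.continuousAt_iff.1 (continuous_tricomiPhi.continuousAt (x := z.1)) δ hδ
    filter_upwards [(tendsto_order.1 hrto).2 (min δ ρ) (lt_min hδ hρ)] with j hj y hy
    have h1 : |y.1 - z.1| ≤ ‖y - z‖ := norm_fst_le (y - z)
    have h2 : |y.2 - z.2| ≤ ‖y - z‖ := norm_snd_le (y - z)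
    have h3 := lt_min_iff.1 hj
    have h4 := hφ (show dist y.1 z.1 < ρ by rw [Real.dist_eq]; linarith [h3.2])
    rw [Real.dist_eq] at h4
    refine ⟨by linarith [neg_abs_le (y.1 - z.1), hδc.2], fun x hx => ⟨hx.1, ?_⟩⟩
    have h5 := hx.2
    have h6 := abs_sub_le x.2 y.2 z.2
    have h7 := le_abs_self (tricomiPhi y.1 - tricomiPhi z.1)
    linarith [hδc.1, h3.1]
  set I := ∫⁻ y in tricomiCone c z.2, ENNReal.ofReal (y.1 ^ (-(1 / 2) : ℝ)) * ‖F y‖ₑ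
  set J := ∫⁻ y in tricomiCone c z.2, ‖w y‖ₑ
  have hJ : J < ⊤ := setLIntegral_tricomiCone_lt_top h.locallyIntegrable_sol c z.2
  refine le_of_tendsto hz.enorm ?_
  filter_upwards [hsmall] with j hj
  set ψ := (φ j).normed volume
  have hψ : ContDiff ℝ ∞ ψ := (φ j).contDiff_normed
  have hψc : HasCompactSupport ψ := (φ j).hasCompactSupport_normed
  have hψ1 : ∫⁻ y, ‖ψ y‖ₑ = 1 :=
    lintegral_enorm_eq_one (fun y => (φ j).nonneg_normed y) (φ j).integral_normed
  rw [← mollify_eq_convolution_swap]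
  -- the isotropic average of `w` is continuous, so forward mollification converges at the point `z`
  have hcont : Continuous (mollify ψ (zeroExt w)) := (contDiff_mollify hψ hψc hw).continuous
  have hlim : Filter.Tendsto (fun n => mollify (k n) (mollify ψ (zeroExt w)) z) Filter.atTop
      (nhds (mollify ψ (zeroExt w) z)) := by
    simp only [mollify_eq_convolution_swap (k _)]
    refine convolution_tendsto_right (Filter.Eventually.of_forall fun n => (hk n).nonneg)
      (Filter.Eventually.of_forall fun n => (hk n).integral_eq_one) ?_
      (Filter.Eventually.of_forall fun n => hcont.aestronglyMeasurable)
      ((hcont.tendsto z).comp Filter.tendsto_snd) tendsto_const_nhds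
    rw [Filter.tendsto_smallSets_iff]
    intro U hU
    obtain ⟨ρ, hρ, hρU⟩ := Metric.mem_nhds_iff.1 hU
    filter_upwards [(tendsto_order.1 hrto).2 ρ hρ] with n hn y hy
    obtain ⟨h1, h2, h3⟩ := (hk n).support y hy
    apply hρU
    rw [mem_ball_zero_iff, Prod.norm_def, max_lt_iff]
    refine ⟨?_, by rw [Real.norm_eq_abs]; linarith⟩
    rw [Real.norm_of_nonneg (by linarith [(hk n).pos])]
    linarith
  have hbound : ∀ᶠ n in Filter.atTop, ‖mollify (k n) (mollify ψ (zeroExt w)) z‖ₑ ≤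
      1 / 2 * (I + ENNReal.ofReal (1 / ((n : ℝ) + 1)) * J) := by
    filter_upwards [Filter.eventually_ge_atTop j] with n hn
    rw [mollify_mollify_comm (hk n).contDiff.continuous (hk n).hasCompactSupport hψ.continuous hψc hw]
    set M := 1 / 2 * (I + ENNReal.ofReal (1 / ((n : ℝ) + 1)) * J)
    calc ‖mollify ψ (mollify (k n) (zeroExt w)) z‖ₑ
        ≤ ∫⁻ y, ‖ψ (z - y)‖ₑ * ‖mollify (k n) (zeroExt w) y‖ₑ := enorm_mollify_le _ _ _
      _ ≤ ∫⁻ y, ‖ψ (z - y)‖ₑ * M := by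
          refine lintegral_mono fun y => ?_
          by_cases h0 : ψ (z - y) = 0
          · simp [h0]
          have h1 : z - y ∈ Function.support ψ := h0
          rw [(φ j).support_normed_eq, mem_ball_zero_iff, ← norm_neg, neg_sub] at h1
          obtain ⟨hy0, hsub⟩ := hj y h1
          have hmono : tricomiCone (tricomiPhi y.1 + 1 / ((n : ℝ) + 1)) y.2 ⊆ tricomiCone c z.2 := by
            intro x hx
            refine hsub ⟨hx.1, hx.2.trans ?_⟩
            have : (1 : ℝ) / (n + 1) ≤ 1 / (j + 1) := by gcongr
            linarith
          gcongr
          refine (enorm_mollify_zeroExt_le h (hk n) hy0 y.2).trans ?_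
          simp only [M]
          gcongr
          · exact lintegral_mono_set hmono
          · exact lintegral_mono_set hmono
      _ = M := by
          have hm : Measurable fun y => ‖ψ y‖ₑ := hψ.continuous.enorm.measurable
          have hm' : Measurable fun y => ‖ψ (z - y)‖ₑ := hm.comp (measurable_const.sub measurable_id)
          rw [lintegral_mul_const _ hm', lintegral_sub_left_eq_self (fun y => ‖ψ y‖ₑ) z, hψ1, one_mul]
  have hM : Filter.Tendsto (fun n : ℕ => 1 / 2 * (I + ENNReal.ofReal (1 / ((n : ℝ) + 1)) * J))
      Filter.atTop (nhds (1 / 2 * I)) := by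
    have h1 : Filter.Tendsto (fun n : ℕ => ENNReal.ofReal (1 / ((n : ℝ) + 1)) * J)
        Filter.atTop (nhds 0) := by
      have := ENNReal.Tendsto.mul_const (b := J) (ENNReal.tendsto_ofReal hrto) (Or.inr hJ.ne)
      simpa using this
    have h2 := ENNReal.Tendsto.const_mul (a := (1 / 2 : ℝ≥0∞)) (h1.const_add I) (Or.inr (by simp))
    simpa using h2
  exact le_of_tendsto_of_tendsto hlim.enorm hM hbound

/-! ### Weighted estimates in the cone -/

lemma lintegral_Ioc_rpow {p a : ℝ} (hp : -1 < p) (ha : 0 ≤ a) :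
    ∫⁻ r in Ioc 0 a, ENNReal.ofReal (r ^ p) = ENNReal.ofReal (a ^ (p + 1) / (p + 1)) := by
  have h1 : IntegrableOn (fun r : ℝ => r ^ p) (Ioc 0 a) :=
    (intervalIntegrable_iff_integrableOn_Ioc_of_le ha).1 (intervalIntegral.intervalIntegrable_rpow' hp)
  rw [← ofReal_integral_eq_lintegral_ofReal h1]
  · rw [← intervalIntegral.integral_of_le ha, integral_rpow (Or.inl hp),
      Real.zero_rpow (by linarith), sub_zero]
  · filter_upwards [ae_restrict_mem measurableSet_Ioc] with r hr using Real.rpow_nonneg hr.1.le p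

lemma lintegral_Ioi_rpow {κ a : ℝ} (hκ : 0 < κ) (ha : 0 < a) :
    ∫⁻ t in Ioi a, ENNReal.ofReal (t ^ (-1 - κ)) = ENNReal.ofReal (a ^ (-κ) / κ) := by
  rw [← ofReal_integral_eq_lintegral_ofReal (integrableOn_Ioi_rpow_of_lt (by linarith) ha)]
  · rw [integral_Ioi_rpow_of_lt (by linarith) ha]
    congr 1
    rw [show -1 - κ + 1 = -κ by ring, neg_div_neg_eq]
  · filter_upwards [ae_restrict_mem measurableSet_Ioi] with r hr using
      Real.rpow_nonneg (ha.trans hr).le _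

/-- The part of the forward cone `|x| < φ(t)` of the origin with `t ∈ I`. -/
def forwardCone (I : Set ℝ) : Set (ℝ × ℝ) := {z | z.1 ∈ I ∧ |z.2| < tricomiPhi z.1}

lemma measurableSet_forwardCone {I : Set ℝ} (hI : MeasurableSet I) :
    MeasurableSet (forwardCone I) := by
  have h : Continuous fun z : ℝ × ℝ => tricomiPhi z.1 := continuous_tricomiPhi.comp continuous_fst
  exact (measurable_fst hI).inter
    (isOpen_lt (continuous_abs.comp continuous_snd) h).measurableSet

lemma setLIntegral_forwardCone {I : Set ℝ} (hI : MeasurableSet I) {g : ℝ × ℝ → ℝ≥0∞}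
    (hg : Measurable g) : ∫⁻ z in forwardCone I, g z =
      ∫⁻ s in I, ∫⁻ y in Ioo (-tricomiPhi s) (tricomiPhi s), g (s, y) := by
  rw [← lintegral_indicator (measurableSet_forwardCone hI), Measure.volume_eq_prod,
    lintegral_prod _ (hg.indicator (measurableSet_forwardCone hI)).aemeasurable,
    ← lintegral_indicator hI]
  refine lintegral_congr fun s => ?_
  by_cases hs : s ∈ I
  · rw [Set.indicator_of_mem hs, ← lintegral_indicator measurableSet_Ioo]
    refine lintegral_congr fun y => ?_
    have : (s, y) ∈ forwardCone I ↔ y ∈ Ioo (-tricomiPhi s) (tricomiPhi s) := by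
      rw [mem_Ioo, ← abs_lt]; exact and_iff_right hs
    by_cases hy : y ∈ Ioo (-tricomiPhi s) (tricomiPhi s)
    · rw [Set.indicator_of_mem hy, Set.indicator_of_mem (this.2 hy)]
    · rw [Set.indicator_of_notMem hy, Set.indicator_of_notMem (fun h => hy (this.1 h))]
  · rw [Set.indicator_of_notMem hs]
    have : ∀ y, (forwardCone I).indicator g (s, y) = 0 := fun y =>
      Set.indicator_of_notMem (fun h => hs h.1) _
    simp [this]

lemma lintegral_sub_sq_rpow_le {a : ℝ} (ha : 0 < a) :
    ∫⁻ x in Ioo (-a) a, ENNReal.ofReal ((a ^ 2 - |x| ^ 2) ^ (-(11 / 12) : ℝ)) ≤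
      ENNReal.ofReal (48 * a ^ (-(5 / 6) : ℝ)) := by
  have hI : ∫⁻ r in Ioc 0 (2 * a), ENNReal.ofReal (r ^ (-(11 / 12) : ℝ)) ≤
      ENNReal.ofReal (24 * a ^ (1 / 12 : ℝ)) := by
    rw [lintegral_Ioc_rpow (by norm_num) (by linarith)]
    apply ENNReal.ofReal_le_ofReal
    rw [show (-(11 / 12) + 1 : ℝ) = 1 / 12 by norm_num, Real.mul_rpow (by norm_num) ha.le]
    have h2 : (2 : ℝ) ^ (1 / 12 : ℝ) ≤ 2 := by
      calc (2 : ℝ) ^ (1 / 12 : ℝ) ≤ 2 ^ (1 : ℝ) :=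
            Real.rpow_le_rpow_of_exponent_le (by norm_num) (by norm_num)
        _ = 2 := Real.rpow_one 2
    have h3 : 0 ≤ a ^ (1 / 12 : ℝ) := by positivity
    rw [div_le_iff₀ (by norm_num)]
    nlinarith
  have hR : ∫⁻ x in Ioo (-a) a, ENNReal.ofReal ((a - x) ^ (-(11 / 12) : ℝ)) ≤
      ENNReal.ofReal (24 * a ^ (1 / 12 : ℝ)) := by
    refine le_trans ?_ hI
    rw [← lintegral_indicator measurableSet_Ioo, ← lintegral_indicator measurableSet_Ioc,
      ← lintegral_sub_left_eq_self ((Ioc 0 (2 * a)).indicator _) a]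
    refine lintegral_mono fun x => ?_
    by_cases hx : x ∈ Ioo (-a) a
    · rw [Set.indicator_of_mem hx, Set.indicator_of_mem (mem_Ioc.2 ⟨by linarith [hx.2], by linarith [hx.1]⟩)]
    · rw [Set.indicator_of_notMem hx]; exact zero_le
  have hL : ∫⁻ x in Ioo (-a) a, ENNReal.ofReal ((a + x) ^ (-(11 / 12) : ℝ)) ≤
      ENNReal.ofReal (24 * a ^ (1 / 12 : ℝ)) := by
    refine le_trans ?_ hI
    rw [← lintegral_indicator measurableSet_Ioo, ← lintegral_indicator measurableSet_Ioc,
      ← lintegral_add_left_eq_self ((Ioc 0 (2 * a)).indicator _) a]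
    refine lintegral_mono fun x => ?_
    by_cases hx : x ∈ Ioo (-a) a
    · rw [Set.indicator_of_mem hx, Set.indicator_of_mem (mem_Ioc.2 ⟨by linarith [hx.1], by linarith [hx.2]⟩)]
    · rw [Set.indicator_of_notMem hx]; exact zero_le
  have hpt : ∀ x ∈ Ioo (-a) a, ENNReal.ofReal ((a ^ 2 - |x| ^ 2) ^ (-(11 / 12) : ℝ)) ≤
      ENNReal.ofReal (a ^ (-(11 / 12) : ℝ)) * (ENNReal.ofReal ((a - x) ^ (-(11 / 12) : ℝ)) +
        ENNReal.ofReal ((a + x) ^ (-(11 / 12) : ℝ))) := by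
    intro x hx
    have h1 : 0 < a - x := by linarith [hx.2]
    have h2 : 0 < a + x := by linarith [hx.1]
    have e : a ^ 2 - |x| ^ 2 = (a - x) * (a + x) := by rw [sq_abs]; ring
    rw [e, Real.mul_rpow h1.le h2.le, ← ENNReal.ofReal_add (by positivity) (by positivity),
      ← ENNReal.ofReal_mul (by positivity)]
    apply ENNReal.ofReal_le_ofReal
    have p1 : 0 ≤ (a - x) ^ (-(11 / 12) : ℝ) := by positivity
    have p2 : 0 ≤ (a + x) ^ (-(11 / 12) : ℝ) := by positivity
    have p3 : 0 ≤ a ^ (-(11 / 12) : ℝ) := by positivity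
    rcases le_total 0 x with h0 | h0
    · have h3 : (a + x) ^ (-(11 / 12) : ℝ) ≤ a ^ (-(11 / 12) : ℝ) :=
        Real.rpow_le_rpow_of_nonpos ha (by linarith) (by norm_num)
      nlinarith [mul_le_mul_of_nonneg_left h3 p1, mul_nonneg p3 p2]
    · have h3 : (a - x) ^ (-(11 / 12) : ℝ) ≤ a ^ (-(11 / 12) : ℝ) :=
        Real.rpow_le_rpow_of_nonpos ha (by linarith) (by norm_num)
      nlinarith [mul_le_mul_of_nonneg_right h3 p2, mul_nonneg p3 p1]
  calc ∫⁻ x in Ioo (-a) a, ENNReal.ofReal ((a ^ 2 - |x| ^ 2) ^ (-(11 / 12) : ℝ))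
      ≤ ∫⁻ x in Ioo (-a) a, ENNReal.ofReal (a ^ (-(11 / 12) : ℝ)) *
          (ENNReal.ofReal ((a - x) ^ (-(11 / 12) : ℝ)) +
            ENNReal.ofReal ((a + x) ^ (-(11 / 12) : ℝ))) :=
        setLIntegral_mono' measurableSet_Ioo hpt
    _ = ENNReal.ofReal (a ^ (-(11 / 12) : ℝ)) *
          ((∫⁻ x in Ioo (-a) a, ENNReal.ofReal ((a - x) ^ (-(11 / 12) : ℝ))) +
            ∫⁻ x in Ioo (-a) a, ENNReal.ofReal ((a + x) ^ (-(11 / 12) : ℝ))) := by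
        rw [lintegral_const_mul' _ _ ENNReal.ofReal_ne_top, lintegral_add_left (by fun_prop)]
    _ ≤ ENNReal.ofReal (a ^ (-(11 / 12) : ℝ)) * (ENNReal.ofReal (24 * a ^ (1 / 12 : ℝ)) +
          ENNReal.ofReal (24 * a ^ (1 / 12 : ℝ))) := by gcongr
    _ = ENNReal.ofReal (48 * a ^ (-(5 / 6) : ℝ)) := by
        rw [← ENNReal.ofReal_add (by positivity) (by positivity),
          ← ENNReal.ofReal_mul (by positivity)]
        congr 1
        rw [show (-(5 / 6) : ℝ) = -(11 / 12) + 1 / 12 by norm_num, Real.rpow_add ha]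
        ring

/-- The Tonelli step of Hardy's inequality, for the truncation `s ≤ 2t`. -/
lemma lintegral_rpow_mul_setLIntegral_le {κ : ℝ} (hκ : 0 < κ) {G : ℝ × ℝ → ℝ≥0∞}
    (hG : AEMeasurable G volume) (hG0 : ∀ z : ℝ × ℝ, z.1 ≤ 0 → G z = 0) :
    ∫⁻ t in Ioi 0, ENNReal.ofReal (t ^ (-1 - κ)) * ∫⁻ z in {z : ℝ × ℝ | z.1 ≤ 2 * t}, G z ≤
      ∫⁻ z, ENNReal.ofReal ((z.1 / 2) ^ (-κ) / κ) * G z := by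
  have hset : MeasurableSet {p : ℝ × (ℝ × ℝ) | p.2.1 ≤ 2 * p.1} :=
    measurableSet_le (by fun_prop) (by fun_prop)
  have hS : ∀ t : ℝ, MeasurableSet {z : ℝ × ℝ | z.1 ≤ 2 * t} := fun t =>
    measurableSet_le (by fun_prop) (by fun_prop)
  set H : ℝ → ℝ × ℝ → ℝ≥0∞ := fun t z =>
    {p : ℝ × (ℝ × ℝ) | p.2.1 ≤ 2 * p.1}.indicator
      (fun p => ENNReal.ofReal (p.1 ^ (-1 - κ)) * G p.2) (t, z)
  calc ∫⁻ t in Ioi 0, ENNReal.ofReal (t ^ (-1 - κ)) * ∫⁻ z in {z : ℝ × ℝ | z.1 ≤ 2 * t}, G z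
      = ∫⁻ t in Ioi (0 : ℝ), ∫⁻ z, H t z := by
        refine lintegral_congr fun t => ?_
        rw [← lintegral_const_mul' _ _ ENNReal.ofReal_ne_top, ← lintegral_indicator (hS t)]
        rfl
    _ = ∫⁻ z, ∫⁻ t in Ioi (0 : ℝ), H t z := by
        refine lintegral_lintegral_swap ?_
        refine AEMeasurable.indicator ?_ hset
        refine AEMeasurable.mul (Measurable.aemeasurable (by fun_prop)) ?_
        exact hG.comp_quasiMeasurePreserving Measure.quasiMeasurePreserving_snd
    _ ≤ ∫⁻ z, ENNReal.ofReal ((z.1 / 2) ^ (-κ) / κ) * G z := by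
        refine lintegral_mono fun z => ?_
        rcases le_or_gt z.1 0 with hz | hz
        · have : ∀ t, H t z = 0 := fun t => by
            simp only [H, Set.indicator]
            split_ifs <;> simp [hG0 z hz]
          simp [this]
        have hz2 : 0 < z.1 / 2 := by linarith
        calc ∫⁻ t in Ioi (0 : ℝ), H t z
            ≤ ∫⁻ t, (Ici (z.1 / 2)).indicator
                (fun t => ENNReal.ofReal (t ^ (-1 - κ)) * G z) t := by
              refine (setLIntegral_le_lintegral _ _).trans (lintegral_mono fun t => ?_)
              by_cases ht : z.1 ≤ 2 * t
              · rw [Set.indicator_of_mem (show t ∈ Ici (z.1 / 2) by rw [mem_Ici]; linarith)]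
                exact Set.indicator_le_self _ _ _
              · simp only [H]
                rw [Set.indicator_of_notMem (show (t, z) ∉ {p : ℝ × (ℝ × ℝ) | p.2.1 ≤ 2 * p.1}
                  from ht)]
                exact zero_le
          _ = ∫⁻ t in Ioi (z.1 / 2), ENNReal.ofReal (t ^ (-1 - κ)) * G z := by
              rw [lintegral_indicator measurableSet_Ici, setLIntegral_congr Ioi_ae_eq_Ici.symm]
          _ = _ := by
              rw [lintegral_mul_const _ (by fun_prop), lintegral_Ioi_rpow hκ hz2]

lemma forwardCone_form_pos {I : Set ℝ} {z : ℝ × ℝ} (hz : z ∈ forwardCone I) :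
    0 < tricomiPhi z.1 ^ 2 - |z.2| ^ 2 := by
  have h1 := hz.2
  have h2 := abs_nonneg z.2
  nlinarith

lemma measurable_tricomiPhi_fst : Measurable fun z : ℝ × ℝ => tricomiPhi z.1 :=
  continuous_tricomiPhi.measurable.comp measurable_fst

lemma tricomiPhi_rpow_le {t e : ℝ} (ht : 0 < t) (he : 0 ≤ e) :
    tricomiPhi t ^ e ≤ t ^ (3 / 2 * e) := by
  have h : tricomiPhi t ≤ t ^ (3 / 2 : ℝ) := by
    have : 0 ≤ t ^ (3 / 2 : ℝ) := by positivity
    unfold tricomiPhi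
    linarith
  calc tricomiPhi t ^ e ≤ (t ^ (3 / 2 : ℝ)) ^ e :=
        Real.rpow_le_rpow (tricomiPhi_pos ht).le h he
    _ = t ^ (3 / 2 * e) := (Real.rpow_mul ht.le _ _).symm

/-- The `L^q` norm of the weight that Hölder's inequality splits off. -/
lemma setLIntegral_holder_weight_le {q T : ℝ} (hq : 6 < q) (hT : 0 < T) :
    ∫⁻ z in forwardCone (Ioc 0 T), ENNReal.ofReal (z.1 ^ (-(1 / 2) - 1 / (8 * q)) *
      (tricomiPhi z.1 ^ 2 - |z.2| ^ 2) ^ (-(3 / (4 * q) - 1 / 6))) ^ q ≤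
      ENNReal.ofReal (16 * T ^ (1 / 8 : ℝ)) := by
  have hq0 : q ≠ 0 := by positivity
  have hm := measurable_tricomiPhi_fst
  calc ∫⁻ z in forwardCone (Ioc 0 T), ENNReal.ofReal (z.1 ^ (-(1 / 2) - 1 / (8 * q)) *
      (tricomiPhi z.1 ^ 2 - |z.2| ^ 2) ^ (-(3 / (4 * q) - 1 / 6))) ^ q
      ≤ ∫⁻ z in forwardCone (Ioc 0 T), ENNReal.ofReal (z.1 ^ (-(q / 2) - 1 / 8) *
          tricomiPhi z.1 ^ (q / 3 - 3 / 2)) := by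
        refine setLIntegral_mono' (measurableSet_forwardCone measurableSet_Ioc) fun z hz => ?_
        have hs : 0 < z.1 := hz.1.1
        have hφ := tricomiPhi_pos hs
        have hΩ := forwardCone_form_pos hz
        rw [ENNReal.ofReal_rpow_of_nonneg (by positivity) (by linarith)]
        apply ENNReal.ofReal_le_ofReal
        rw [Real.mul_rpow (by positivity) (by positivity), ← Real.rpow_mul hs.le,
          ← Real.rpow_mul hΩ.le, show (-(1 / 2) - 1 / (8 * q)) * q = -(q / 2) - 1 / 8 by field_simp,
          show -(3 / (4 * q) - 1 / 6) * q = q / 6 - 3 / 4 by field_simp; ring]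
        have h1 : (tricomiPhi z.1 ^ 2 - |z.2| ^ 2) ^ (q / 6 - 3 / 4) ≤
            (tricomiPhi z.1 ^ 2) ^ (q / 6 - 3 / 4) :=
          Real.rpow_le_rpow hΩ.le (by nlinarith [sq_nonneg |z.2|]) (by linarith)
        have h2 : (tricomiPhi z.1 ^ 2) ^ (q / 6 - 3 / 4) = tricomiPhi z.1 ^ (q / 3 - 3 / 2) := by
          rw [← Real.rpow_natCast, ← Real.rpow_mul hφ.le]
          congr 1
          push_cast; ring
        rw [← h2]
        gcongr
    _ = ∫⁻ s in Ioc 0 T, ∫⁻ _ in Ioo (-tricomiPhi s) (tricomiPhi s),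
          ENNReal.ofReal (s ^ (-(q / 2) - 1 / 8) * tricomiPhi s ^ (q / 3 - 3 / 2)) :=
        setLIntegral_forwardCone measurableSet_Ioc (by fun_prop)
    _ ≤ ∫⁻ s in Ioc 0 T, 2 * ENNReal.ofReal (s ^ (-(7 / 8) : ℝ)) := by
        refine setLIntegral_mono' measurableSet_Ioc fun s hs => ?_
        have hs0 : 0 < s := hs.1
        have hφ := tricomiPhi_pos hs0
        rw [setLIntegral_const, Real.volume_Ioo, ← ENNReal.ofReal_mul (by positivity),
          show (2 : ℝ≥0∞) = ENNReal.ofReal 2 by simp, ← ENNReal.ofReal_mul (by norm_num)]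
        apply ENNReal.ofReal_le_ofReal
        have h1 := tricomiPhi_rpow_le hs0 (show 0 ≤ q / 3 - 1 / 2 by linarith)
        have h2 : tricomiPhi s ^ (q / 3 - 3 / 2) * tricomiPhi s = tricomiPhi s ^ (q / 3 - 1 / 2) := by
          rw [← Real.rpow_add_one hφ.ne']
          congr 1; ring
        have h3 : s ^ (-(q / 2) - 1 / 8) * s ^ (3 / 2 * (q / 3 - 1 / 2)) = s ^ (-(7 / 8) : ℝ) := by
          rw [← Real.rpow_add hs0]
          congr 1; ring
        calc s ^ (-(q / 2) - 1 / 8) * tricomiPhi s ^ (q / 3 - 3 / 2) * (tricomiPhi s - -tricomiPhi s)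
            = 2 * (s ^ (-(q / 2) - 1 / 8) * (tricomiPhi s ^ (q / 3 - 3 / 2) * tricomiPhi s)) := by ring
          _ ≤ 2 * (s ^ (-(q / 2) - 1 / 8) * s ^ (3 / 2 * (q / 3 - 1 / 2))) := by
              rw [h2]; gcongr
          _ = 2 * s ^ (-(7 / 8) : ℝ) := by rw [h3]
    _ = ENNReal.ofReal (16 * T ^ (1 / 8 : ℝ)) := by
        rw [lintegral_const_mul' _ _ (by simp), lintegral_Ioc_rpow (by norm_num) hT.le,
          show (2 : ℝ≥0∞) = ENNReal.ofReal 2 by simp, ← ENNReal.ofReal_mul (by norm_num)]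
        congr 1
        rw [show (-(7 / 8) + 1 : ℝ) = 1 / 8 by norm_num]
        ring

/-- Integration of the singular weight `(φ² - x²)^{-11/12}` over the slices of the cone. -/
lemma setLIntegral_singular_weight_le {H : ℝ → ℝ≥0∞} (hH : Measurable H) :
    ∫⁻ z in forwardCone (Ioi 0),
      ENNReal.ofReal ((tricomiPhi z.1 ^ 2 - |z.2| ^ 2) ^ (-(11 / 12) : ℝ)) * H z.1 ≤
      ∫⁻ t in Ioi 0, ENNReal.ofReal (72 * t ^ (-(5 / 4) : ℝ)) * H t := by
  have hm := measurable_tricomiPhi_fst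
  have hg : Measurable fun z : ℝ × ℝ =>
      ENNReal.ofReal ((tricomiPhi z.1 ^ 2 - |z.2| ^ 2) ^ (-(11 / 12) : ℝ)) * H z.1 := by fun_prop
  rw [setLIntegral_forwardCone measurableSet_Ioi hg]
  refine setLIntegral_mono' measurableSet_Ioi fun t ht => ?_
  replace ht : 0 < t := ht
  have hφ := tricomiPhi_pos ht
  simp only
  rw [lintegral_mul_const _ (by fun_prop)]
  gcongr
  refine (lintegral_sub_sq_rpow_le hφ).trans (ENNReal.ofReal_le_ofReal ?_)
  have h1 : tricomiPhi t ^ (-(5 / 6) : ℝ) = (2 / 3 : ℝ) ^ (-(5 / 6) : ℝ) * t ^ (-(5 / 4) : ℝ) := by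
    unfold tricomiPhi
    rw [Real.mul_rpow (by norm_num) (by positivity), ← Real.rpow_mul ht.le]
    norm_num
  have h2 : (2 / 3 : ℝ) ^ (-(5 / 6) : ℝ) ≤ 3 / 2 := by
    calc (2 / 3 : ℝ) ^ (-(5 / 6) : ℝ) ≤ (2 / 3 : ℝ) ^ (-1 : ℝ) :=
          Real.rpow_le_rpow_of_exponent_ge (by norm_num) (by norm_num) (by norm_num)
      _ = 3 / 2 := by rw [Real.rpow_neg_one]; norm_num
  have h3 : 0 ≤ t ^ (-(5 / 4) : ℝ) := by positivity
  rw [h1]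
  nlinarith

/-- Hölder's inequality for the integral of `s^{-1/2} Φ` over the part `s ≤ T` of the cone. -/
lemma setLIntegral_le_holder {q T : ℝ} (hq : 6 < q) (hT : 0 < T) {Φ : ℝ × ℝ → ℝ≥0∞}
    (hΦ : AEMeasurable Φ halfPlaneMeasure) :
    ∫⁻ y in forwardCone (Ioc 0 T), ENNReal.ofReal (y.1 ^ (-(1 / 2) : ℝ)) * Φ y ≤
      ENNReal.ofReal (16 * T ^ (1 / 8 : ℝ)) ^ (1 / q) *
      (∫⁻ y in forwardCone (Ioc 0 T), ENNReal.ofReal (y.1 ^ (1 / (8 * (q - 1)))) *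
        (‖(tricomiPhi y.1 ^ 2 - |y.2| ^ 2) ^ (3 / (4 * q) - 1 / 6)‖ₑ * Φ y) ^ (q / (q - 1))) ^
          (1 / (q / (q - 1))) := by
  have hq1 : q - 1 ≠ 0 := by linarith
  have hq0 : q ≠ 0 := by positivity
  have hm := measurable_tricomiPhi_fst
  have hD := measurableSet_forwardCone (measurableSet_Ioc (a := (0 : ℝ)) (b := T))
  have hsub : forwardCone (Ioc 0 T) ⊆ {z : ℝ × ℝ | 0 < z.1} := fun z hz => hz.1.1
  have hΦ' : AEMeasurable Φ (volume.restrict (forwardCone (Ioc 0 T))) :=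
    hΦ.mono_measure (Measure.restrict_mono hsub le_rfl)
  have hconj : q.HolderConjugate (q / (q - 1)) := Real.HolderConjugate.conjExponent (by linarith)
  have hN : Measurable fun y : ℝ × ℝ =>
      ‖(tricomiPhi y.1 ^ 2 - |y.2| ^ 2) ^ (3 / (4 * q) - 1 / 6)‖ₑ := by fun_prop
  have hHolder := ENNReal.lintegral_mul_le_Lp_mul_Lq (volume.restrict (forwardCone (Ioc 0 T))) hconj
    (f := fun z => ENNReal.ofReal (z.1 ^ (-(1 / 2) - 1 / (8 * q)) *
      (tricomiPhi z.1 ^ 2 - |z.2| ^ 2) ^ (-(3 / (4 * q) - 1 / 6))))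
    (g := fun z => ENNReal.ofReal (z.1 ^ (1 / (8 * q))) *
      (‖(tricomiPhi z.1 ^ 2 - |z.2| ^ 2) ^ (3 / (4 * q) - 1 / 6)‖ₑ * Φ z))
    (Measurable.aemeasurable (by fun_prop))
    ((Measurable.aemeasurable (by fun_prop)).mul (hN.aemeasurable.mul hΦ'))
  calc ∫⁻ y in forwardCone (Ioc 0 T), ENNReal.ofReal (y.1 ^ (-(1 / 2) : ℝ)) * Φ y
      = _ := by
        refine setLIntegral_congr_fun hD fun z hz => ?_
        have hs : 0 < z.1 := hz.1.1
        have hΩ := forwardCone_form_pos hz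
        simp only [Pi.mul_apply]
        rw [← mul_assoc, ← mul_assoc, ← ofReal_norm, Real.norm_of_nonneg (by positivity),
          ← ENNReal.ofReal_mul (by positivity), ← ENNReal.ofReal_mul (by positivity)]
        congr 2
        calc z.1 ^ (-(1 / 2) : ℝ) = z.1 ^ (-(1 / 2) - 1 / (8 * q)) * z.1 ^ (1 / (8 * q)) := by
              rw [← Real.rpow_add hs]; congr 1; ring
          _ = z.1 ^ (-(1 / 2) - 1 / (8 * q)) * z.1 ^ (1 / (8 * q)) *
              ((tricomiPhi z.1 ^ 2 - |z.2| ^ 2) ^ (-(3 / (4 * q) - 1 / 6)) *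
              (tricomiPhi z.1 ^ 2 - |z.2| ^ 2) ^ (3 / (4 * q) - 1 / 6)) := by
              rw [← Real.rpow_add hΩ, neg_add_cancel, Real.rpow_zero, mul_one]
          _ = _ := by ring
    _ ≤ _ := hHolder
    _ ≤ _ := by
        refine mul_le_mul' (ENNReal.rpow_le_rpow ?_ (one_div_nonneg.2 hconj.pos.le))
          (ENNReal.rpow_le_rpow ?_ (one_div_nonneg.2 hconj.symm.pos.le))
        · exact setLIntegral_holder_weight_le hq hT
        · refine setLIntegral_mono' hD fun z hz => ?_
          have hs : 0 < z.1 := hz.1.1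
          rw [ENNReal.mul_rpow_of_nonneg _ _ (by have := hconj.symm.pos; positivity),
            ENNReal.ofReal_rpow_of_nonneg (by positivity) hconj.symm.pos.le, ← Real.rpow_mul hs.le,
            show 1 / (8 * q) * (q / (q - 1)) = 1 / (8 * (q - 1)) by field_simp]

/-! ### The weighted estimate -/

/-- The weighted `L^{q'} → L^q` bound for functions dominated by the time integral of
`s^{-1/2} Φ`. -/
theorem lintegral_weighted_le {q : ℝ} (hq : 6 < q) {W Φ : ℝ × ℝ → ℝ≥0∞}
    (hΦ : AEMeasurable Φ halfPlaneMeasure)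
    (hΦ0 : ∀ᵐ z ∂halfPlaneMeasure, tricomiPhi z.1 ≤ |z.2| → Φ z = 0)
    (hW0 : ∀ᵐ z ∂halfPlaneMeasure, tricomiPhi z.1 ≤ |z.2| → W z = 0)
    (hWΦ : ∀ᵐ z ∂halfPlaneMeasure, W z ≤ ∫⁻ y in {y : ℝ × ℝ | 0 < y.1 ∧ y.1 ≤ 2 * z.1},
      ENNReal.ofReal (y.1 ^ (-(1 / 2) : ℝ)) * Φ y) :
    ∫⁻ z, (‖(tricomiPhi z.1 ^ 2 - |z.2| ^ 2) ^ (-(11 / (12 * q)))‖ₑ * W z) ^ q ∂halfPlaneMeasure ≤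
      ENNReal.ofReal (36864 * (q - 1)) *
        (∫⁻ z, (‖(tricomiPhi z.1 ^ 2 - |z.2| ^ 2) ^ (3 / (4 * q) - 1 / 6)‖ₑ * Φ z) ^ (q / (q - 1))
          ∂halfPlaneMeasure) ^ (q - 1) := by
  have hq1 : 0 < q - 1 := by linarith
  have hq0 : 0 < q := by linarith
  have hm := measurable_tricomiPhi_fst
  set κ := 1 / (8 * (q - 1)) with hκ
  have hκ0 : 0 < κ := by positivity
  have hκ1 : κ ≤ 1 / 40 := by
    rw [hκ]
    apply one_div_le_one_div_of_le <;> linarith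
  have hκq : κ * (q - 2) = 1 / 8 - κ := by rw [hκ]; field_simp; ring
  set N : ℝ × ℝ → ℝ≥0∞ := fun z =>
    (‖(tricomiPhi z.1 ^ 2 - |z.2| ^ 2) ^ (3 / (4 * q) - 1 / 6)‖ₑ * Φ z) ^ (q / (q - 1)) with hNdef
  have hN : AEMeasurable N halfPlaneMeasure := by
    have : Measurable fun z : ℝ × ℝ =>
      ‖(tricomiPhi z.1 ^ 2 - |z.2| ^ 2) ^ (3 / (4 * q) - 1 / 6)‖ₑ := by fun_prop
    exact (this.aemeasurable.mul hΦ).pow_const _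
  set L := ∫⁻ z, N z ∂halfPlaneMeasure
  have hS := measurableSet_forwardCone (measurableSet_Ioi (a := (0 : ℝ)))
  have hSsub : forwardCone (Ioi 0) ⊆ {z : ℝ × ℝ | 0 < z.1} := fun z hz => hz.1
  have hNS : AEMeasurable N (volume.restrict (forwardCone (Ioi 0))) :=
    hN.mono_measure (Measure.restrict_mono hSsub le_rfl)
  set G : ℝ × ℝ → ℝ≥0∞ := (forwardCone (Ioi 0)).indicator fun z => ENNReal.ofReal (z.1 ^ κ) * N z
  have hG : AEMeasurable G volume := by
    refine (aemeasurable_indicator_iff hS).2 ?_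
    exact (Measurable.aemeasurable (by fun_prop)).mul hNS
  set J : ℝ → ℝ≥0∞ := fun T => ∫⁻ z in {z : ℝ × ℝ | z.1 ≤ T}, G z
  have hJmono : Monotone J := fun s t hst => lintegral_mono_set fun z hz => le_trans hz hst
  have hT : ∀ T : ℝ, MeasurableSet {z : ℝ × ℝ | z.1 ≤ T} := fun T =>
    measurableSet_le measurable_fst measurable_const
  have hJeq : ∀ T, J T = ∫⁻ z in forwardCone (Ioc 0 T), ENNReal.ofReal (z.1 ^ κ) * N z := by
    intro T
    simp only [J, G]
    rw [setLIntegral_indicator hS]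
    congr 2
    ext z
    exact ⟨fun h => ⟨⟨h.1.1, h.2⟩, h.1.2⟩, fun h => ⟨⟨h.1.1, h.2⟩, h.1.2⟩⟩
  have hJL : ∀ T, J T ≤ ENNReal.ofReal (T ^ κ) * L := by
    intro T
    rw [hJeq, ← lintegral_const_mul' _ _ ENNReal.ofReal_ne_top]
    refine (setLIntegral_mono' (measurableSet_forwardCone measurableSet_Ioc)
      (g := fun z => ENNReal.ofReal (T ^ κ) * N z) fun z hz => ?_).trans
      (lintegral_mono_set fun z hz => hz.1.1)
    gcongr
    · exact hz.1.1.le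
    · exact hz.1.2
  -- the pointwise bound in the cone
  have hpt : ∀ᵐ z ∂halfPlaneMeasure, W z ^ q ≤
      ENNReal.ofReal (32 * z.1 ^ (1 / 4 - κ)) * J (2 * z.1) * L ^ (q - 2) := by
    filter_upwards [hWΦ, ae_restrict_mem measurableSet_halfPlane] with z hz hz0
    replace hz0 : 0 < z.1 := hz0
    have hT0 : 0 < 2 * z.1 := by linarith
    have hP : MeasurableSet {y : ℝ × ℝ | 0 < y.1 ∧ y.1 ≤ 2 * z.1} :=
      measurableSet_halfPlane.inter (hT _)
    have h1 : ∫⁻ y in {y : ℝ × ℝ | 0 < y.1 ∧ y.1 ≤ 2 * z.1},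
        ENNReal.ofReal (y.1 ^ (-(1 / 2) : ℝ)) * Φ y ≤
        ∫⁻ y in forwardCone (Ioc 0 (2 * z.1)), ENNReal.ofReal (y.1 ^ (-(1 / 2) : ℝ)) * Φ y := by
      have hC := measurableSet_forwardCone (measurableSet_Ioc (a := (0 : ℝ)) (b := 2 * z.1))
      rw [← inter_eq_left.2 (show forwardCone (Ioc 0 (2 * z.1)) ⊆
        {y : ℝ × ℝ | 0 < y.1 ∧ y.1 ≤ 2 * z.1} from fun y hy => hy.1), ← setLIntegral_indicator hC]
      have h0 : ∀ᵐ y ∂volume.restrict {y : ℝ × ℝ | 0 < y.1 ∧ y.1 ≤ 2 * z.1},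
          tricomiPhi y.1 ≤ |y.2| → Φ y = 0 :=
        ae_restrict_of_ae_restrict_of_subset (fun y hy => hy.1) hΦ0
      refine lintegral_mono_ae ?_
      filter_upwards [h0, ae_restrict_mem hP] with y hy hyP
      by_cases hyC : |y.2| < tricomiPhi y.1
      · rw [Set.indicator_of_mem (show y ∈ forwardCone (Ioc 0 (2 * z.1)) from ⟨hyP, hyC⟩)]
      · rw [hy (not_lt.1 hyC), mul_zero]; exact zero_le
    have h2 := hz.trans (h1.trans (setLIntegral_le_holder hq hT0 hΦ))
    rw [← hJeq] at h2
    have e1 : (1 / (q / (q - 1))) * q = 1 + (q - 2) := by field_simp; ring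
    calc W z ^ q ≤ (ENNReal.ofReal (16 * (2 * z.1) ^ (1 / 8 : ℝ)) ^ (1 / q) *
          J (2 * z.1) ^ (1 / (q / (q - 1)))) ^ q := ENNReal.rpow_le_rpow h2 hq0.le
      _ = ENNReal.ofReal (16 * (2 * z.1) ^ (1 / 8 : ℝ)) * (J (2 * z.1) * J (2 * z.1) ^ (q - 2)) := by
          rw [ENNReal.mul_rpow_of_nonneg _ _ hq0.le, ← ENNReal.rpow_mul, ← ENNReal.rpow_mul, e1,
            one_div_mul_cancel hq0.ne', ENNReal.rpow_one,
            ENNReal.rpow_add_of_nonneg _ _ zero_le_one (by linarith), ENNReal.rpow_one]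
      _ ≤ ENNReal.ofReal (16 * (2 * z.1) ^ (1 / 8 : ℝ)) *
          (J (2 * z.1) * (ENNReal.ofReal ((2 * z.1) ^ κ) * L) ^ (q - 2)) := by
          gcongr
          · linarith
          · exact hJL _
      _ = (ENNReal.ofReal (16 * (2 * z.1) ^ (1 / 8 : ℝ)) *
            ENNReal.ofReal ((2 * z.1) ^ (κ * (q - 2)))) * J (2 * z.1) * L ^ (q - 2) := by
          rw [ENNReal.mul_rpow_of_nonneg _ _ (by linarith),
            ENNReal.ofReal_rpow_of_nonneg (by positivity) (by linarith), ← Real.rpow_mul hT0.le]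
          ring
      _ ≤ ENNReal.ofReal (32 * z.1 ^ (1 / 4 - κ)) * J (2 * z.1) * L ^ (q - 2) := by
          gcongr
          rw [← ENNReal.ofReal_mul (by positivity)]
          apply ENNReal.ofReal_le_ofReal
          rw [mul_assoc, ← Real.rpow_add hT0, hκq, show (1 / 8 + (1 / 8 - κ) : ℝ) = 1 / 4 - κ by ring,
            Real.mul_rpow (by norm_num) hz0.le]
          have h3 : (2 : ℝ) ^ (1 / 4 - κ) ≤ 2 := by
            calc (2 : ℝ) ^ (1 / 4 - κ) ≤ 2 ^ (1 : ℝ) :=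
                  Real.rpow_le_rpow_of_exponent_le (by norm_num) (by linarith)
              _ = 2 := Real.rpow_one 2
          have h4 : 0 ≤ z.1 ^ (1 / 4 - κ) := by positivity
          nlinarith
  set H : ℝ → ℝ≥0∞ := fun t => ENNReal.ofReal (32 * t ^ (1 / 4 - κ)) * J (2 * t) * L ^ (q - 2)
  have hJ2 : Measurable fun t => J (2 * t) := hJmono.measurable.comp (measurable_const_mul 2)
  have hH : Measurable H := by
    have : Measurable fun t : ℝ => ENNReal.ofReal (32 * t ^ (1 / 4 - κ)) := by fun_prop
    exact (this.mul hJ2).mul_const _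
  calc ∫⁻ z, (‖(tricomiPhi z.1 ^ 2 - |z.2| ^ 2) ^ (-(11 / (12 * q)))‖ₑ * W z) ^ q ∂halfPlaneMeasure
      ≤ ∫⁻ z, (forwardCone (Ioi 0)).indicator (fun z =>
          ENNReal.ofReal ((tricomiPhi z.1 ^ 2 - |z.2| ^ 2) ^ (-(11 / 12) : ℝ)) * H z.1) z
          ∂halfPlaneMeasure := by
        refine lintegral_mono_ae ?_
        filter_upwards [hpt, hW0, ae_restrict_mem measurableSet_halfPlane] with z hz hz0 hzP
        by_cases hzC : |z.2| < tricomiPhi z.1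
        · have hzS : z ∈ forwardCone (Ioi 0) := ⟨hzP, hzC⟩
          have hΩ := forwardCone_form_pos hzS
          rw [Set.indicator_of_mem hzS, ENNReal.mul_rpow_of_nonneg _ _ hq0.le]
          refine mul_le_mul' (le_of_eq ?_) hz
          rw [← ofReal_norm, Real.norm_of_nonneg (by positivity),
            ENNReal.ofReal_rpow_of_nonneg (by positivity) hq0.le, ← Real.rpow_mul hΩ.le]
          congr 2
          field_simp
        · rw [hz0 (not_lt.1 hzC), mul_zero, ENNReal.zero_rpow_of_pos hq0]
          exact zero_le
    _ = ∫⁻ z in forwardCone (Ioi 0),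
          ENNReal.ofReal ((tricomiPhi z.1 ^ 2 - |z.2| ^ 2) ^ (-(11 / 12) : ℝ)) * H z.1 := by
        rw [halfPlaneMeasure, setLIntegral_indicator hS, inter_eq_left.2 hSsub]
    _ ≤ ∫⁻ t in Ioi 0, ENNReal.ofReal (72 * t ^ (-(5 / 4) : ℝ)) * H t :=
        setLIntegral_singular_weight_le hH
    _ = ∫⁻ t in Ioi 0, 2304 * L ^ (q - 2) * (ENNReal.ofReal (t ^ (-1 - κ)) * J (2 * t)) := by
        refine setLIntegral_congr_fun measurableSet_Ioi fun t ht => ?_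
        replace ht : 0 < t := ht
        have e : ENNReal.ofReal (72 * t ^ (-(5 / 4) : ℝ)) * ENNReal.ofReal (32 * t ^ (1 / 4 - κ)) =
            2304 * ENNReal.ofReal (t ^ (-1 - κ)) := by
          rw [← ENNReal.ofReal_mul (by positivity),
            show (2304 : ℝ≥0∞) = ENNReal.ofReal 2304 by simp, ← ENNReal.ofReal_mul (by norm_num)]
          congr 1
          rw [show (-1 - κ : ℝ) = -(5 / 4) + (1 / 4 - κ) by ring, Real.rpow_add ht]
          ring
        simp only [H]
        rw [← mul_assoc, ← mul_assoc, e]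
        ring
    _ = 2304 * L ^ (q - 2) * ∫⁻ t in Ioi 0, ENNReal.ofReal (t ^ (-1 - κ)) * J (2 * t) := by
        have : Measurable fun t : ℝ => ENNReal.ofReal (t ^ (-1 - κ)) := by fun_prop
        exact lintegral_const_mul _ (this.mul hJ2)
    _ ≤ 2304 * L ^ (q - 2) * ∫⁻ z, ENNReal.ofReal ((z.1 / 2) ^ (-κ) / κ) * G z := by
        gcongr
        refine lintegral_rpow_mul_setLIntegral_le hκ0 hG fun z hz => ?_
        exact Set.indicator_of_notMem (fun h => (not_lt.2 hz) h.1) _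
    _ ≤ 2304 * L ^ (q - 2) * (ENNReal.ofReal (16 * (q - 1)) * L) := by
        gcongr
        calc ∫⁻ z, ENNReal.ofReal ((z.1 / 2) ^ (-κ) / κ) * G z
            ≤ ∫⁻ z, (forwardCone (Ioi 0)).indicator
                (fun z => ENNReal.ofReal (16 * (q - 1)) * N z) z := by
              refine lintegral_mono fun z => ?_
              by_cases hz : z ∈ forwardCone (Ioi 0)
              · have hz0 : 0 < z.1 := hz.1
                simp only [G]
                rw [Set.indicator_of_mem hz, Set.indicator_of_mem hz, ← mul_assoc,
                  ← ENNReal.ofReal_mul (by positivity)]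
                refine mul_le_mul' (ENNReal.ofReal_le_ofReal ?_) le_rfl
                rw [Real.div_rpow hz0.le (by norm_num), Real.rpow_neg hz0.le,
                  Real.rpow_neg (by norm_num)]
                have h3 : (2 : ℝ) ^ κ ≤ 2 := by
                  calc (2 : ℝ) ^ κ ≤ 2 ^ (1 : ℝ) :=
                        Real.rpow_le_rpow_of_exponent_le (by norm_num) (by linarith)
                    _ = 2 := Real.rpow_one 2
                have h4 : 0 < z.1 ^ κ := by positivity
                have h5 : κ⁻¹ = 8 * (q - 1) := by rw [hκ]; simp
                calc (z.1 ^ κ)⁻¹ / (2 ^ κ)⁻¹ / κ * z.1 ^ κ = 2 ^ κ * κ⁻¹ := by field_simp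
                  _ ≤ 2 * κ⁻¹ := by gcongr
                  _ = 16 * (q - 1) := by rw [h5]; ring
              · simp only [G]
                rw [Set.indicator_of_notMem hz, mul_zero]
                exact zero_le
          _ = ENNReal.ofReal (16 * (q - 1)) * ∫⁻ z in forwardCone (Ioi 0), N z := by
              rw [lintegral_indicator hS, lintegral_const_mul' _ _ ENNReal.ofReal_ne_top]
          _ ≤ _ := by
              gcongr
              exact lintegral_mono_set hSsub
    _ = ENNReal.ofReal (36864 * (q - 1)) * L ^ (q - 1) := by
        have e : L ^ (q - 1) = L ^ (q - 2) * L := by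
          rw [show q - 1 = (q - 2) + 1 by ring,
            ENNReal.rpow_add_of_nonneg _ _ (by linarith) zero_le_one, ENNReal.rpow_one]
        have e2 : ENNReal.ofReal (36864 * (q - 1)) = 2304 * ENNReal.ofReal (16 * (q - 1)) := by
          rw [show (2304 : ℝ≥0∞) = ENNReal.ofReal 2304 by simp, ← ENNReal.ofReal_mul (by norm_num)]
          congr 1; ring
        rw [e, e2]
        ring

theorem theorem3p2 (p q : ℝ) (hp : 5 < p) (hp' : p < 9) (hq : q = 1 + p) :
    ∃ α β : ℝ, α + 1 / 6 + β = 5 / (3 * q) ∧ β < 1 / q ∧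
      ∃ C : ℝ, 0 < C ∧ ∀ w F : ℝ × ℝ → ℝ, IsWeakTricomiSolution w F →
        (∀ᵐ z ∂halfPlaneMeasure, tricomiPhi z.1 - 1 < |z.2| → F z = 0) →
          (∀ᵐ z ∂halfPlaneMeasure, tricomiPhi z.1 - 1 < |z.2| → w z = 0) ∧
          eLpNorm (fun z : ℝ × ℝ => (tricomiPhi z.1 ^ 2 - |z.2| ^ 2) ^ (-α) * w z)
              (ENNReal.ofReal q) halfPlaneMeasure ≤
            ENNReal.ofReal C *
              eLpNorm (fun z : ℝ × ℝ => (tricomiPhi z.1 ^ 2 - |z.2| ^ 2) ^ β * F z)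
                (ENNReal.ofReal (q / (q - 1))) halfPlaneMeasure := by
  have hq6 : 6 < q := by linarith
  have hq0 : 0 < q := by linarith
  have hq1 : 0 < q - 1 := by linarith
  refine ⟨11 / (12 * q), 3 / (4 * q) - 1 / 6, by field_simp; ring, ?_,
    (36864 * (q - 1)) ^ (1 / q), by positivity, fun w F h hF => ?_⟩
  · have h1 : 3 / (4 * q) = 3 / 4 * (1 / q) := by field_simp
    have h2 : 0 < 1 / q := by positivity
    rw [h1]; linarith
  have hbound := ae_enorm_le_setLIntegral_tricomiCone h
  have hw : ∀ᵐ z ∂halfPlaneMeasure, tricomiPhi z.1 - 1 < |z.2| → w z = 0 := by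
    filter_upwards [hbound] with z hz hzx
    -- if `|x| > φ(t) - 1`, a slightly enlarged backward cone still avoids the support of `F`
    obtain ⟨c, hc1, hc2⟩ := exists_between (show tricomiPhi z.1 < |z.2| + 1 by linarith)
    have h0 : ∫⁻ y in tricomiCone c z.2, ENNReal.ofReal (y.1 ^ (-(1 / 2) : ℝ)) * ‖F y‖ₑ = 0 := by
      rw [← lintegral_zero (μ := volume.restrict (tricomiCone c z.2))]
      have hF' : ∀ᵐ y ∂volume.restrict (tricomiCone c z.2), tricomiPhi y.1 - 1 < |y.2| → F y = 0 :=
        ae_restrict_of_ae_restrict_of_subset (fun y hy => hy.1) hF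
      refine lintegral_congr_ae ?_
      filter_upwards [hF', ae_restrict_mem (measurableSet_tricomiCone c z.2)] with y hy hyc
      have h1 := hyc.2
      have h2 := abs_sub_abs_le_abs_sub z.2 y.2
      rw [abs_sub_comm] at h2
      rw [hy (by linarith)]
      simp
    have := hz c hc1
    rw [h0, mul_zero] at this
    simpa using this
  refine ⟨hw, ?_⟩
  have hFm : AEMeasurable (fun z => ‖F z‖ₑ) halfPlaneMeasure := by
    refine (aemeasurable_enorm_zeroExt h.locallyIntegrable_rhs).restrict.congr ?_
    filter_upwards [ae_restrict_mem measurableSet_halfPlane] with z hz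
    rw [zeroExt_of_pos F hz]
  have key := lintegral_weighted_le hq6 (W := fun z => ‖w z‖ₑ) (Φ := fun z => ‖F z‖ₑ) hFm
    (by filter_upwards [hF] with z hz hzx; simp [hz (by linarith)])
    (by filter_upwards [hw] with z hz hzx; simp [hz (by linarith)])
    (by
      filter_upwards [hbound, ae_restrict_mem measurableSet_halfPlane] with z hz hz0
      replace hz0 : 0 < z.1 := hz0
      have h2 := strictMonoOn_tricomiPhi.lt_iff_lt hz0.le (show (0 : ℝ) ≤ 2 * z.1 by linarith)
      refine (hz (tricomiPhi (2 * z.1)) (h2.2 (by linarith))).trans ?_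
      refine (mul_le_of_le_one_left' (by simp)).trans (lintegral_mono_set fun y hy => ⟨hy.1, ?_⟩)
      rw [← strictMonoOn_tricomiPhi.le_iff_le hy.1.le (show (0 : ℝ) ≤ 2 * z.1 by linarith)]
      linarith [hy.2, abs_nonneg (y.2 - z.2)])
  have hqc : 0 < q / (q - 1) := by positivity
  rw [eLpNorm_eq_lintegral_rpow_enorm_toReal (by simpa using hq0) ENNReal.ofReal_ne_top,
    eLpNorm_eq_lintegral_rpow_enorm_toReal (by simpa using hqc) ENNReal.ofReal_ne_top,
    ENNReal.toReal_ofReal hq0.le, ENNReal.toReal_ofReal hqc.le]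
  simp only [enorm_mul]
  refine (ENNReal.rpow_le_rpow key (by positivity)).trans (le_of_eq ?_)
  rw [ENNReal.mul_rpow_of_nonneg _ _ (by positivity),
    ENNReal.ofReal_rpow_of_nonneg (by positivity) (by positivity), ← ENNReal.rpow_mul]
  congr 2
  field_simp
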